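/- **Setting.** An *augmented virtual double category* $\mathcal K$ consists of a category of objects and vertical morphisms $f\colon A\to C$; horizontal morphisms $J\colon A ⇸ B$; and cells $\phi\colon \underline J\Rightarrow \underline L$ with vertical source $f\colon A\to C$ and vertical target $g\colon B\to D$, whose horizontal source $\underline J\colon A ⇸ B$ is any (possibly empty) path of horizontal morphisms and whose horizontal target $\underline L\colon C ⇸ D$ is a path of length $1$ (*unary* cells) or $0$ (*nullary* cells, with $C=D$). It has identity cells $\mathrm{id}_J\colon J\Rightarrow J$ and nullary identity cells $\mathrm{id}_f$, and vertical composites $\psi\circ(\phi_1,\dots,\phi_n)$, which are associative and unital, satisfy $\mathrm{id}_h\circ\mathrm{id}_f=\mathrm{id}_{h\circ f}$, and do not change when an identity cell $\mathrm{id}_f$ is inserted in the path $(\phi_1,\dots,\phi_n)$. For nullary cells write $\phi\odot\psi=\mathrm{id}_M\circ(\phi,\psi)$, and write $e\circ\phi=\mathrm{id}_e\circ\phi$. A *functor* of augmented virtual double categories preserves all of this structure. A cell $\psi\colon \underline J\Rightarrow\underline L$ with $|\underline J|\le 1$ and vertical boundary $f,g$ is *cartesian* if every cell $\chi\colon\underline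 H\Rightarrow\underline L$ with vertical boundary $f\circ h, g\circ k$ factors uniquely as $\chi=\psi\circ\phi$. If $\underline J=J$ has length $1$, then $J$ is the *restriction* $L(f,g)$ (or $C(f,g)$, if $\underline L$ is empty at $C$). The *companion* of $f\colon A\to C$ is $f_*=C(f,\mathrm{id})$, and $A$ is *unital* if $A(\mathrm{id},\mathrm{id})$ exists. A nullary cell $\eta\colon\underline J\Rightarrow M$ with vertical boundary $d,l$ is *left Kan* (and $l$ is the left Kan extension of $d$ along $\underline J$) if every nullary cell $\underline J\frown\underline H\Rightarrow M$ with vertical source $d$ factors uniquely as $\eta\odot\phi'$. A vertical morphism $\mathrm y\colon A\to P$ is a *Yoneda morphism* if every cartesian nullary cell $J\Rightarrow P$ with vertical source $\mathrm y$ is left Kan and if, for every $J\colon A⇸B$, there are $J^\lambda\colon B\to P$ and a cartesian nullary cell $J\Rightarrow P$ with vertical boundary $\mathrm y,J^\lambda$. A path of cells $\underline\phi$ with last vertical target $f_n$ is *right cocartesian* if all nullary and all unary cells factor uniquely through it, and likewise through $\underline\phi\frown(\mathrm{cart},\mathrm{id}_{K_2},\dots,\mathrm{id}_{K_q})$ for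 every path $(K_1,\dots,K_q)$, $q\ge1$, such that $K_1(f_n,\mathrm{id})$ exists, where $\mathrm{cart}$ defines $K_1(f_n,\mathrm{id})$. A cell $\phi\colon(H_1,\dots,H_n)\Rightarrow J$, $n\ge1$, with identity vertical boundaries is *pointwise right cocartesian*, and $J$ is a *pointwise right composite* of $(H_1,\dots,H_n)$, if $\phi$ is right cocartesian and, for every $f$ such that $H_n(\mathrm{id},f)$ exists, $J(\mathrm{id},f)$ exists and the factorisation $(H_1,\dots,H_n(\mathrm{id},f))\Rightarrow J(\mathrm{id},f)$ of $\phi\circ(\mathrm{id},\dots,\mathrm{id},\mathrm{cart})$ is right cocartesian. Let $F\colon\mathcal K\to\mathcal L$ be a functor of augmented virtual double categories. A horizontal morphism $\iota\colon A⇸FA'$ of $\mathcal L$ is *locally universal from $A$ to $F$* if (a) for each $J\colon A'⇸B$ in $\mathcal K$ the pointwise right composite $J^\flat\colon A⇸FB$ of $(\iota,FJ)$ (the *adjunct* of $J$) exists; (b) for each $h\colon X\to A'$ the restriction $\iota(\mathrm{id},Fh)$ exists; and (c) for all $h\colon X_0\to A'$, $k\colon X_n\to B$, $\underline H\colon X_0⇸X_n$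 and $J\colon A'⇸B$ the assignment $\phi\mapsto\mathrm{cocart}\circ(\mathrm{cart},F\phi)$, where $\mathrm{cocart}$ and $\mathrm{cart}$ define $J^\flat$ and $\iota(\mathrm{id},Fh)$, is a bijection from the cells $\underline H\Rightarrow J$ with vertical boundary $h,k$ to the cells $(\iota(\mathrm{id},Fh))\frown F\underline H\Rightarrow J^\flat$ with vertical boundary $\mathrm{id}_A,Fk$. For $X\in\mathcal L$ the category $F/X$ has as objects pairs $(B,f\colon FB\to X)$, as morphisms $(B,f)\to(C,g)$ pairs $(\underline H,\phi)$ of a path $\underline H\colon B⇸C$ in $\mathcal K$ and a nullary cell $\phi\colon F\underline H\Rightarrow X$ with vertical boundary $f,g$, and composition given by $\odot$; put $\mathcal K/C'=\mathrm{id}_{\mathcal K}/C'$. For a full subcategory $\mathcal J\subseteq F/C$, a morphism $\varepsilon\colon FC'\to C$ is *universal from $F$ to $C$ relative to $\mathcal J$* if the functor $\varepsilon\circ F{-}\colon\mathcal K/C'\to F/C$ is full and faithful and factors through $\mathcal J$ as an equivalence $\mathcal K/C'\simeq\mathcal J$. Given a Yoneda morphism $\mathrm y_A\colon A\to\widehat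 A$ in $\mathcal L$, let $(F/\widehat A)_\iota\subseteq F/\widehat A$ be the full subcategory of the $\iota$*-small* morphisms, i.e. those $f\colon FB\to\widehat A$ that are the left Kan extension of $\mathrm y_A$ along $J^\flat$ for some $J\colon A'⇸B$ in $\mathcal K$. **Theorem.** Let $F\colon\mathcal K\to\mathcal L$ be a functor of augmented virtual double categories and $\iota\colon A⇸FA'$ a locally universal morphism from $A$ to $F$. Let $\mathrm y_A\colon A\to\widehat A$ and $\mathrm y_{A'}\colon A'\to\widehat{A'}$ be Yoneda morphisms, in $\mathcal L$ and $\mathcal K$ respectively, such that, for every $f\colon B\to\widehat{A'}$ in $\mathcal K$, the restrictions $\widehat{A'}(\mathrm y_{A'},f)$ and $(\mathrm y_{A'*})^\flat(\mathrm{id},Ff)$ exist, and such that $F$ preserves (the cartesian cells defining) all $\widehat{A'}(\mathrm y_{A'},f)$. Then there exists a morphism $\varepsilon:=((\mathrm y_{A'*})^\flat)^\lambda\colon F\widehat{A'}\to\widehat A$ equipped with a cartesian nullary cell $(\mathrm y_{A'*})^\flat\Rightarrow\widehat A$ with vertical boundary $\mathrm y_A,\varepsilon$, and every such $\varepsilon$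 is universal from $F$ to $\widehat A$ relative to $(F/\widehat A)_\iota$. If moreover $A'$ is unital, then there exists a cartesian nullary cell $\iota\Rightarrow\widehat A$ with vertical boundary $\mathrm y_A$, $\varepsilon\circ F\mathrm y_{A'}$. -/

import Mathlib

open CategoryTheory

namespace AVDC

/-! ## Paths of horizontal morphisms -/

/-- A type of objects with horizontal morphisms between them. -/
class HorData.{w, u} (𝒦 : Type u) where
  /-- horizontal morphisms `A ⇸ B` -/
  Hor : 𝒦 → 𝒦 → Type w


/-- (Possibly empty) paths of horizontal morphisms. -/
inductive HPath.{w, u} {𝒦 : Type u} [HorData.{w} 𝒦] : 𝒦 → 𝒦 → Type (max u w)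
  | nil (A : 𝒦) : HPath A A
  | cons {A B C : 𝒦} (J : HorData.Hor A B) (Js : HPath B C) : HPath A C

/-- Paths of horizontal morphisms of length at most one. -/
inductive HTgt.{w, u} {𝒦 : Type u} [HorData.{w} 𝒦] : 𝒦 → 𝒦 → Type (max u w)
  | nil (C : 𝒦) : HTgt C C
  | single {C D : 𝒦} (K : HorData.Hor C D) : HTgt C D

section Paths

universe w₁ u₁ w₂ u₂
variable {𝒦 : Type u₁} [HorData.{w₁} 𝒦] {ℒ : Type u₂} [HorData.{w₂} ℒ]

/-- A path of length at most one, as a path. -/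
@[reducible] def HTgt.toPath : ∀ {C D : 𝒦}, HTgt C D → HPath C D
  | _, _, .nil C => .nil C
  | _, _, .single K => .cons K (.nil _)

/-- Concatenation of paths. -/
@[reducible] def HPath.append {A B C : 𝒦} : HPath A B → HPath B C → HPath A C
  | .nil _, H => H
  | .cons J Js, H => .cons J (Js.append H)

theorem HPath.append_nil {A B : 𝒦} (J : HPath A B) : J.append (.nil B) = J := by
  induction J with
  | nil => rfl
  | cons J Js ih => simp [HPath.append, ih]

theorem HPath.append_assoc {A B C D : 𝒦} (J : HPath A B) (H : HPath B C) (K : HPath C D) :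
    (J.append H).append K = J.append (H.append K) := by
  induction J with
  | nil => rfl
  | cons J Js ih => simp [HPath.append, ih]

/-- The image of a path under a map of objects and horizontal morphisms. -/
@[reducible] def HPath.map (o : 𝒦 → ℒ) (m : ∀ {A B : 𝒦}, HorData.Hor A B → HorData.Hor (o A) (o B)) :
    ∀ {A B : 𝒦}, HPath A B → HPath (o A) (o B)
  | _, _, .nil A => .nil (o A)
  | _, _, .cons J Js => .cons (m J) (HPath.map o m Js)

/-- The image of a path of length at most one. -/
@[reducible] def HTgt.map (o : 𝒦 → ℒ) (m : ∀ {A B : 𝒦}, HorData.Hor A B → HorData.Hor (o A) (o B)) :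
    ∀ {A B : 𝒦}, HTgt A B → HTgt (o A) (o B)
  | _, _, .nil A => .nil (o A)
  | _, _, .single K => .single (m K)

theorem HPath.map_append (o : 𝒦 → ℒ)
    (m : ∀ {A B : 𝒦}, HorData.Hor A B → HorData.Hor (o A) (o B))
    {A B C : 𝒦} (J : HPath A B) (H : HPath B C) :
    (J.append H).map o m = (J.map o m).append (H.map o m) := by
  induction J with
  | nil => rfl
  | cons J Js ih => simp [HPath.append, HPath.map, ih]

theorem HTgt.toPath_map (o : 𝒦 → ℒ)
    (m : ∀ {A B : 𝒦}, HorData.Hor A B → HorData.Hor (o A) (o B))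
    {A B : 𝒦} (L : HTgt A B) : (L.map o m).toPath = L.toPath.map o m := by
  cases L <;> rfl

end Paths

/-! ## Augmented virtual double categories -/

/-- An augmented virtual graph: a category of objects and vertical morphisms, horizontal
morphisms, and cells
```
      A --J₁--> ... --Jₙ--> B
     f|                     |g
      C ---------L--------> D
```
whose horizontal source is any path and whose horizontal target is a path of length at most one;
the cell is *unary* if `L = .single K` and *nullary* if `L = .nil C`. -/
class AugVirtGraph.{w, x, v, u} (𝒦 : Type u) extends Category.{v} 𝒦, HorData.{w} 𝒦 where
  Cell : ∀ {A B C D : 𝒦}, (A ⟶ C) → HPath A B → (B ⟶ D) → HTgt C D → Type x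

open AugVirtGraph (Cell)

/-- Paths of cells `(φ₁, …, φₙ)`, where the vertical target of each `φᵢ` is the vertical source
of `φᵢ₊₁`. The first path of horizontal morphisms is the concatenation of the horizontal sources,
the second that of the horizontal targets; to avoid transports along equalities of paths these
concatenations are recorded as equations. The empty path at a vertical morphism `f` is included;
vertical composition will identify it with the singleton path consisting of the identity cell
of `f`. -/
inductive CellPath.{w, x, v, u} {𝒦 : Type u} [AugVirtGraph.{w, x, v} 𝒦] :
    ∀ {A B C D : 𝒦}, (A ⟶ C) → HPath A B → (B ⟶ D) → HPath C D → Type (max u v w x)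
  | nil {A C : 𝒦} (f : A ⟶ C) : CellPath f (.nil A) f (.nil C)
  | cons {A B E C D G : 𝒦} {f : A ⟶ C} {g : B ⟶ D} {h : E ⟶ G}
      {J : HPath A B} {L : HTgt C D} {J' : HPath B E} {K' : HPath D G}
      {P : HPath A E} {Q : HPath C G}
      (φ : Cell f J g L) (Φ : CellPath g J' h K')
      (hP : P = J.append J') (hQ : Q = L.toPath.append K') : CellPath f P h Q

/-- A path of paths of cells `Φ₁, …, Φₙ` together with cells `ψ₁, …, ψₙ` such that `Φᵢ` and `ψᵢ`
are vertically composable. In `Grid f h J K M g k` the (concatenated) horizontal source is `J`, the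
intermediate path is `K`, the horizontal target is `M`, and the vertical boundaries are `f, h` on
the left and `g, k` on the right. -/
inductive Grid.{w, x, v, u} {𝒦 : Type u} [AugVirtGraph.{w, x, v} 𝒦] :
    ∀ {A B C D E G : 𝒦}, (A ⟶ C) → (C ⟶ E) → HPath A B → HPath C D → HPath E G →
      (B ⟶ D) → (D ⟶ G) → Type (max u v w x)
  | nil {A C E : 𝒦} (f : A ⟶ C) (h : C ⟶ E) : Grid f h (.nil A) (.nil C) (.nil E) f h
  | cons {A B B' C D D' E G G' : 𝒦} {f : A ⟶ C} {h : C ⟶ E} {g : B ⟶ D} {k : D ⟶ G}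
      {g' : B' ⟶ D'} {k' : D' ⟶ G'}
      {J : HPath A B} {K : HPath C D} {L : HTgt E G}
      {J' : HPath B B'} {K' : HPath D D'} {M' : HPath G G'}
      {P : HPath A B'} {Q : HPath C D'} {R : HPath E G'}
      (Φ : CellPath f J g K) (ψ : Cell h K k L) (Γ : Grid g k J' K' M' g' k')
      (hP : P = J.append J') (hQ : Q = K.append K') (hR : R = L.toPath.append M') :
      Grid f h P Q R g' k'

section Graph

universe w x v u
variable {𝒦 : Type u} [AugVirtGraph.{w, x, v} 𝒦]

/-- The path consisting of a single cell. -/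
def CellPath.single {A B C D : 𝒦} {f : A ⟶ C} {J : HPath A B} {g : B ⟶ D} {L : HTgt C D}
    (φ : Cell f J g L) : CellPath f J g L.toPath :=
  .cons φ (.nil g) J.append_nil.symm L.toPath.append_nil.symm

/-- Concatenation of paths of cells, with the concatenated horizontal boundaries given up to
equality. -/
def CellPath.appendEq {A B E C D G : 𝒦} {f : A ⟶ C} {g : B ⟶ D} {h : E ⟶ G}
    {J : HPath A B} {K : HPath C D} {J' : HPath B E} {K' : HPath D G}
    {P : HPath A E} {Q : HPath C G} :
    CellPath f J g K → CellPath g J' h K' → P = J.append J' → Q = K.append K' →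
      CellPath f P h Q
  | .nil _, Ψ, hP, hQ => match P, Q, hP, hQ with
    | _, _, rfl, rfl => Ψ
  | .cons φ Φ hJ hK, Ψ, hP, hQ => .cons φ (Φ.appendEq Ψ rfl rfl)
      (by rw [hP, hJ, HPath.append_assoc]) (by rw [hQ, hK, HPath.append_assoc])

theorem CellPath.appendEq_nil_heq {A B C D : 𝒦} {f : A ⟶ C} {g : B ⟶ D}
    {J : HPath A B} {K : HPath C D} (Φ : CellPath f J g K) :
    ∀ {P : HPath A B} {Q : HPath C D} (hP : P = J.append (.nil B)) (hQ : Q = K.append (.nil D)),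
      HEq (Φ.appendEq (.nil g) hP hQ) Φ := by
  induction Φ with
  | nil f =>
    intro P Q hP hQ
    subst hP hQ
    rfl
  | cons φ Φ hJ hK ih =>
    intro P Q hP hQ
    have e := ih rfl rfl
    rw [HPath.append_nil] at hP hQ
    subst hP hQ
    have aux : ∀ {A B E C D G : 𝒦} {f : A ⟶ C} {g : B ⟶ D} {h : E ⟶ G}
        {J : HPath A B} {L : HTgt C D} {J₁ J₂ : HPath B E} {K₁ K₂ : HPath D G}
        {P : HPath A E} {Q : HPath C G} (φ : Cell f J g L) (Φ₁ : CellPath g J₁ h K₁)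
        (Φ₂ : CellPath g J₂ h K₂) (h₁ : P = J.append J₁) (h₂ : Q = L.toPath.append K₁)
        (h₃ : P = J.append J₂) (h₄ : Q = L.toPath.append K₂), J₁ = J₂ → K₁ = K₂ → HEq Φ₁ Φ₂ →
        HEq (CellPath.cons φ Φ₁ h₁ h₂) (CellPath.cons φ Φ₂ h₃ h₄) := by
      intros
      subst_vars
      rfl
    exact aux _ _ _ _ _ _ _ (HPath.append_nil _) (HPath.append_nil _) e

theorem CellPath.appendEq_nil {A B C D : 𝒦} {f : A ⟶ C} {g : B ⟶ D}
    {J : HPath A B} {K : HPath C D} (Φ : CellPath f J g K) (hP : J = J.append (.nil B))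
    (hQ : K = K.append (.nil D)) : Φ.appendEq (.nil g) hP hQ = Φ :=
  eq_of_heq (Φ.appendEq_nil_heq hP hQ)

/-- Concatenation of paths of cells. -/
def CellPath.append {A B E C D G : 𝒦} {f : A ⟶ C} {g : B ⟶ D} {h : E ⟶ G}
    {J : HPath A B} {K : HPath C D} {J' : HPath B E} {K' : HPath D G}
    (Φ : CellPath f J g K) (Ψ : CellPath g J' h K') :
    CellPath f (J.append J') h (K.append K') :=
  Φ.appendEq Ψ rfl rfl

/-- The concatenation `Φ₁ ⌢ ⋯ ⌢ Φₙ`. -/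
def Grid.top {A B C D E G : 𝒦} {f : A ⟶ C} {h : C ⟶ E} {J : HPath A B} {K : HPath C D}
    {M : HPath E G} {g : B ⟶ D} {k : D ⟶ G} : Grid f h J K M g k → CellPath f J g K
  | .nil f _ => .nil f
  | .cons Φ _ Γ hP hQ _ => Φ.appendEq Γ.top hP hQ

/-- The path `(ψ₁, …, ψₙ)`. -/
def Grid.bot {A B C D E G : 𝒦} {f : A ⟶ C} {h : C ⟶ E} {J : HPath A B} {K : HPath C D}
    {M : HPath E G} {g : B ⟶ D} {k : D ⟶ G} : Grid f h J K M g k → CellPath h K k M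
  | .nil _ h => .nil h
  | .cons _ ψ Γ _ hQ hR => .cons ψ Γ.bot hQ hR

end Graph

/-- Vertical composition and identity cells on an augmented virtual graph. -/
class AugVirtComp.{w, x, v, u} (𝒦 : Type u) extends AugVirtGraph.{w, x, v} 𝒦 where
  /-- The vertical composite `ψ ∘ (φ₁, …, φₙ)`. Its vertical source and target are
  `f ≫ h` and `g ≫ k`. -/
  vcomp : ∀ {A B C D E G : 𝒦} {f : A ⟶ C} {J : HPath A B} {g : B ⟶ D} {K : HPath C D}
    {h : C ⟶ E} {k : D ⟶ G} {L : HTgt E G} {p : A ⟶ E} {q : B ⟶ G},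
    CellPath f J g K → Cell h K k L → f ≫ h = p → g ≫ k = q → Cell p J q L
  /-- The identity cell of a horizontal morphism. -/
  idH : ∀ {A B : 𝒦} (J : HorData.Hor A B), Cell (𝟙 A) (HTgt.single J).toPath (𝟙 B) (.single J)
  /-- The (nullary) identity cell of a vertical morphism. -/
  idV : ∀ {A C : 𝒦} (f : A ⟶ C), Cell f (.nil A) f (.nil C)

section Comp

universe w x v u
variable {𝒦 : Type u} [AugVirtComp.{w, x, v} 𝒦]

/-- The path of identity cells `(id_{J₁}, …, id_{Jₙ})`. -/
def idPath : ∀ {A B : 𝒦} (J : HPath A B), CellPath (𝟙 A) J (𝟙 B) J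
  | _, _, .nil A => .nil (𝟙 A)
  | _, _, .cons J Js => .cons (AugVirtComp.idH J) (idPath Js) rfl rfl

/-- The path of composites `(ψ₁ ∘ Φ₁, …, ψₙ ∘ Φₙ)`. -/
def Grid.comps {A B C D E G : 𝒦} {f : A ⟶ C} {h : C ⟶ E} {J : HPath A B} {K : HPath C D}
    {M : HPath E G} {g : B ⟶ D} {k : D ⟶ G} :
    Grid f h J K M g k → CellPath (f ≫ h) J (g ≫ k) M
  | .nil f h => .nil (f ≫ h)
  | .cons Φ ψ Γ hP _ hR => .cons (AugVirtComp.vcomp Φ ψ rfl rfl) Γ.comps hP hR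

end Comp

/-- Augmented virtual double categories. -/
class AugVirtDblCat.{w, x, v, u} (𝒦 : Type u) extends AugVirtComp.{w, x, v} 𝒦 where
  /-- `χ ∘ (ψ₁ ∘ Φ₁, …, ψₙ ∘ Φₙ) = (χ ∘ (ψ₁, …, ψₙ)) ∘ (Φ₁ ⌢ ⋯ ⌢ Φₙ)` -/
  vcomp_assoc : ∀ {A B C D E G X Y : 𝒦} {f : A ⟶ C} {h : C ⟶ E} {J : HPath A B} {K : HPath C D}
    {M : HPath E G} {g : B ⟶ D} {k : D ⟶ G} (Γ : Grid f h J K M g k)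
    {l : E ⟶ X} {r : G ⟶ Y} {L : HTgt X Y} (χ : Cell l M r L),
    vcomp Γ.comps χ (Category.assoc f h l) (Category.assoc g k r) =
      vcomp Γ.top (vcomp Γ.bot χ rfl rfl) rfl rfl
  /-- `id_C ∘ φ = φ` -/
  idV_vcomp : ∀ {A B C : 𝒦} {f : A ⟶ C} {J : HPath A B} {g : B ⟶ C} (φ : Cell f J g (.nil C)),
    vcomp (.single φ) (idV (𝟙 C)) (Category.comp_id f) (Category.comp_id g) = φ
  /-- `id_K ∘ φ = φ` -/
  idH_vcomp : ∀ {A B C D : 𝒦} {f : A ⟶ C} {J : HPath A B} {g : B ⟶ D} {K : HorData.Hor C D}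
    (φ : Cell f J g (.single K)),
    vcomp (.single φ) (idH K) (Category.comp_id f) (Category.comp_id g) = φ
  /-- `φ ∘ (id_{J₁}, …, id_{Jₙ}) = φ` -/
  vcomp_id : ∀ {A B C D : 𝒦} {f : A ⟶ C} {J : HPath A B} {g : B ⟶ D} {L : HTgt C D}
    (φ : Cell f J g L), vcomp (idPath J) φ (Category.id_comp f) (Category.id_comp g) = φ
  /-- `id_h ∘ id_f = id_{h ∘ f}` -/
  idV_idV : ∀ {A C E : 𝒦} (f : A ⟶ C) (h : C ⟶ E),
    vcomp (.single (idV f)) (idV h) rfl rfl = idV (f ≫ h)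
  /-- `ψ ∘ (φ₁, …, φᵢ, id_g, φᵢ₊₁, …, φₙ) = ψ ∘ (φ₁, …, φₙ)`, where `g` is the common vertical
  boundary of `φᵢ` and `φᵢ₊₁` -/
  vcomp_insert : ∀ {A B E C D G X Y : 𝒦} {f : A ⟶ C} {g : B ⟶ D} {h : E ⟶ G}
    {J : HPath A B} {K : HPath C D} {J' : HPath B E} {K' : HPath D G}
    (Φ : CellPath f J g K) (Φ' : CellPath g J' h K')
    {l : C ⟶ X} {r : G ⟶ Y} {L : HTgt X Y} (ψ : Cell l (K.append K') r L),
    vcomp (Φ.append (.cons (idV g) Φ' rfl rfl)) ψ rfl rfl = vcomp (Φ.append Φ') ψ rfl rfl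

open AugVirtComp (vcomp idH idV)

section Basic

universe w x v u
variable {𝒦 : Type u} [AugVirtDblCat.{w, x, v} 𝒦]

theorem vcomp_assoc' {A B C D E G X Y : 𝒦} {f : A ⟶ C} {h : C ⟶ E} {J : HPath A B}
    {K : HPath C D} {M : HPath E G} {g : B ⟶ D} {k : D ⟶ G} (Γ : Grid f h J K M g k)
    {l : E ⟶ X} {r : G ⟶ Y} {L : HTgt X Y} (χ : Cell l M r L)
    {a : C ⟶ X} {b : D ⟶ Y} (ha : h ≫ l = a) (hb : k ≫ r = b)
    {p : A ⟶ X} {q : B ⟶ Y} (hp : (f ≫ h) ≫ l = p) (hq : (g ≫ k) ≫ r = q)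
    (hp' : f ≫ a = p) (hq' : g ≫ b = q) :
    vcomp Γ.comps χ hp hq = vcomp Γ.top (vcomp Γ.bot χ ha hb) hp' hq' := by
  subst ha hb hp' hq'
  exact AugVirtDblCat.vcomp_assoc Γ χ

theorem vcomp_insert' {A B E C D G X Y : 𝒦} {f : A ⟶ C} {g : B ⟶ D} {h : E ⟶ G}
    {J : HPath A B} {K : HPath C D} {J' : HPath B E} {K' : HPath D G}
    (Φ : CellPath f J g K) (Φ' : CellPath g J' h K')
    {l : C ⟶ X} {r : G ⟶ Y} {L : HTgt X Y} (ψ : Cell l (K.append K') r L)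
    {p : A ⟶ X} {q : E ⟶ Y} (hp : f ≫ l = p) (hq : h ≫ r = q) :
    vcomp (Φ.append (.cons (idV g) Φ' rfl rfl)) ψ hp hq = vcomp (Φ.append Φ') ψ hp hq := by
  subst hp hq
  exact AugVirtDblCat.vcomp_insert Φ Φ' ψ

/-- Transport of a cell along equalities of its vertical boundaries. -/
def copy {A B C D : 𝒦} {f f' : A ⟶ C} {J : HPath A B} {g g' : B ⟶ D} {L : HTgt C D}
    (φ : Cell f J g L) (hf : f = f') (hg : g = g') : Cell f' J g' L :=
  match f', g', hf, hg with
  | _, _, rfl, rfl => φ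

/-- The horizontal composite `φ ⊙ ψ = id_M ∘ (φ, ψ)` of nullary cells, with horizontal source
`P = J ⌢ H`. -/
def hcomp {A B C M : 𝒦} {f : A ⟶ M} {g : B ⟶ M} {h : C ⟶ M} {J : HPath A B} {H : HPath B C}
    {P : HPath A C} (φ : Cell f J g (.nil M)) (ψ : Cell g H h (.nil M))
    (hP : P = J.append H) : Cell f P h (.nil M) :=
  vcomp (.cons φ (.single ψ) hP rfl) (idV (𝟙 M)) (Category.comp_id f) (Category.comp_id h)

/-- The composite `e ∘ φ = id_e ∘ φ` of a nullary cell `φ` with a vertical morphism `e`. -/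
def whisker {A B M N : 𝒦} {f : A ⟶ M} {g : B ⟶ M} {J : HPath A B}
    (φ : Cell f J g (.nil M)) (e : M ⟶ N) : Cell (f ≫ e) J (g ≫ e) (.nil N) :=
  vcomp (.single φ) (idV e) rfl rfl

theorem idV_hcomp {A B M : 𝒦} {f : A ⟶ M} {g : B ⟶ M} {J : HPath A B}
    (φ : Cell f J g (.nil M)) : hcomp (idV f) φ rfl = φ :=
  (vcomp_insert' (.nil f) (.single φ) (idV (𝟙 M)) (Category.comp_id f) (Category.comp_id g)).trans
    (AugVirtDblCat.idV_vcomp φ)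

theorem hcomp_idV {A B M : 𝒦} {f : A ⟶ M} {g : B ⟶ M} {J : HPath A B}
    (φ : Cell f J g (.nil M)) : hcomp φ (idV g) J.append_nil.symm = φ := by
  have key : ∀ (P : HPath A B) (hP : P = J.append (.nil B)),
      vcomp (.cons φ (.single (idV g)) hP rfl) (idV (𝟙 M))
        (Category.comp_id f) (Category.comp_id g) =
      vcomp (.cons φ (.nil g) hP rfl) (idV (𝟙 M)) (Category.comp_id f) (Category.comp_id g) := by
    intro P hP
    subst hP
    exact vcomp_insert' (.single φ) (.nil g) (idV (𝟙 M)) _ _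
  exact (key J J.append_nil.symm).trans (AugVirtDblCat.idV_vcomp φ)

theorem idV_idV' {A C E : 𝒦} (f : A ⟶ C) (h : C ⟶ E) {p : A ⟶ E} (hp : f ≫ h = p) :
    vcomp (.single (idV f)) (idV h) hp hp = idV p := by
  subst hp
  exact AugVirtDblCat.idV_idV f h

theorem vcomp_idV₂ {A C E : 𝒦} (f : A ⟶ C) (h : C ⟶ E) {p : A ⟶ E} (hp : f ≫ h = p) :
    vcomp (.cons (idV f) (.single (idV f)) rfl rfl) (idV h) hp hp = idV p :=
  (vcomp_insert' (.nil f) (.single (idV f)) (idV h) hp hp).trans (idV_idV' f h hp)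

theorem hcomp_assoc {A B C D M : 𝒦} {f : A ⟶ M} {g : B ⟶ M} {h : C ⟶ M} {k : D ⟶ M}
    {J : HPath A B} {H : HPath B C} {K : HPath C D} {P : HPath A C} {Q : HPath B D}
    {R : HPath A D} (φ : Cell f J g (.nil M)) (ψ : Cell g H h (.nil M)) (χ : Cell h K k (.nil M))
    (hP : P = J.append H) (hR : R = P.append K) (hQ : Q = H.append K) (hR' : R = J.append Q) :
    hcomp (hcomp φ ψ hP) χ hR = hcomp φ (hcomp ψ χ hQ) hR' := by
  have left : ∀ {f' p : A ⟶ M} {h' : C ⟶ M} {k' q : D ⟶ M}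
      (hf : f ≫ 𝟙 M = f') (hh : h ≫ 𝟙 M = h') (hk : k ≫ 𝟙 M = k')
      (hp : f' ≫ 𝟙 M = p) (hq : k' ≫ 𝟙 M = q) (hp' : f ≫ 𝟙 M = p) (hq' : k ≫ 𝟙 M = q),
      vcomp (.cons (vcomp (.cons φ (.single ψ) hP rfl) (idV (𝟙 M)) hf hh)
        (.single (vcomp (.single χ) (idV (𝟙 M)) hh hk)) hR rfl) (idV (𝟙 M)) hp hq =
      vcomp (.cons φ (.cons ψ (.single χ) hQ rfl) hR' rfl) (idV (𝟙 M)) hp' hq' := by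
    intro f' p h' k' q hf hh hk hp hq hp' hq'
    subst hf hh hk
    refine (vcomp_assoc' (.cons (.cons φ (.single ψ) hP rfl) (idV (𝟙 M))
      (.cons (.single χ) (idV (𝟙 M)) (.nil k (𝟙 M)) K.append_nil.symm rfl rfl) hR rfl rfl)
      (idV (𝟙 M)) (Category.comp_id _) (Category.comp_id _) hp hq hp' hq').trans ?_
    refine (congrArg (fun t => vcomp _ t hp' hq') (vcomp_idV₂ (𝟙 M) (𝟙 M) _)).trans ?_
    subst hP hQ
    rfl
  have right : ∀ {f' p : A ⟶ M} {g' : B ⟶ M} {k' q : D ⟶ M}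
      (hf : f ≫ 𝟙 M = f') (hg : g ≫ 𝟙 M = g') (hk : k ≫ 𝟙 M = k')
      (hp : f' ≫ 𝟙 M = p) (hq : k' ≫ 𝟙 M = q) (hp' : f ≫ 𝟙 M = p) (hq' : k ≫ 𝟙 M = q),
      vcomp (.cons (vcomp (.single φ) (idV (𝟙 M)) hf hg)
        (.single (vcomp (.cons ψ (.single χ) hQ rfl) (idV (𝟙 M)) hg hk)) hR' rfl)
        (idV (𝟙 M)) hp hq =
      vcomp (.cons φ (.cons ψ (.single χ) hQ rfl) hR' rfl) (idV (𝟙 M)) hp' hq' := by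
    intro f' p g' k' q hf hg hk hp hq hp' hq'
    subst hf hg hk
    refine (vcomp_assoc' (.cons (.single φ) (idV (𝟙 M))
      (.cons (.cons ψ (.single χ) hQ rfl) (idV (𝟙 M)) (.nil k (𝟙 M)) Q.append_nil.symm rfl rfl)
        hR' rfl rfl)
      (idV (𝟙 M)) (Category.comp_id _) (Category.comp_id _) hp hq hp' hq').trans ?_
    refine (congrArg (fun t => vcomp _ t hp' hq') (vcomp_idV₂ (𝟙 M) (𝟙 M) _)).trans ?_
    have e := CellPath.appendEq_nil (.cons ψ (.single χ) hQ rfl) Q.append_nil.symm rfl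
    exact congrArg (fun t => vcomp (.cons φ t hR' rfl) (idV (𝟙 M)) hp' hq') e
  have l := left (Category.comp_id f) (Category.comp_id h) (Category.comp_id k)
    (Category.comp_id f) (Category.comp_id k) (Category.comp_id f) (Category.comp_id k)
  have r := right (Category.comp_id f) (Category.comp_id g) (Category.comp_id k)
    (Category.comp_id f) (Category.comp_id k) (Category.comp_id f) (Category.comp_id k)
  rw [AugVirtDblCat.idV_vcomp] at l r
  exact l.trans r.symm

theorem whisker_idV {A M N : 𝒦} (f : A ⟶ M) (e : M ⟶ N) :
    whisker (idV f) e = idV (f ≫ e) :=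
  AugVirtDblCat.idV_idV f e

theorem whisker_hcomp {A B C M N : 𝒦} {f : A ⟶ M} {g : B ⟶ M} {h : C ⟶ M} {J : HPath A B}
    {H : HPath B C} {P : HPath A C} (φ : Cell f J g (.nil M)) (ψ : Cell g H h (.nil M))
    (hP : P = J.append H) (e : M ⟶ N) :
    whisker (hcomp φ ψ hP) e = hcomp (whisker φ e) (whisker ψ e) hP := by
  have left : ∀ {f' : A ⟶ M} {h' : C ⟶ M} {p : A ⟶ N} {q : C ⟶ N}
      (hf : f ≫ 𝟙 M = f') (hh : h ≫ 𝟙 M = h')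
      (hp : f' ≫ e = p) (hq : h' ≫ e = q) (hp' : f ≫ e = p) (hq' : h ≫ e = q),
      vcomp (.single (vcomp (.cons φ (.single ψ) hP rfl) (idV (𝟙 M)) hf hh)) (idV e) hp hq =
      vcomp (.cons φ (.single ψ) hP rfl) (idV e) hp' hq' := by
    intro f' h' p q hf hh hp hq hp' hq'
    subst hf hh
    refine (vcomp_assoc' (.cons (.cons φ (.single ψ) hP rfl) (idV (𝟙 M))
      (.nil h (𝟙 M)) P.append_nil.symm rfl rfl)
      (idV e) (Category.id_comp _) (Category.id_comp _) hp hq hp' hq').trans ?_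
    refine (congrArg (fun t => vcomp _ t hp' hq') (idV_idV' (𝟙 M) e _)).trans ?_
    have e₁ := CellPath.appendEq_nil (.cons φ (.single ψ) hP rfl) P.append_nil.symm rfl
    exact congrArg (fun t => vcomp t _ hp' hq') e₁
  have right : ∀ {p : A ⟶ N} {q : C ⟶ N} (hp : (f ≫ e) ≫ 𝟙 N = p) (hq : (h ≫ e) ≫ 𝟙 N = q)
      (hp' : f ≫ e = p) (hq' : h ≫ e = q),
      vcomp (.cons (vcomp (.single φ) (idV e) rfl rfl)
        (.single (vcomp (.single ψ) (idV e) rfl rfl)) hP rfl) (idV (𝟙 N)) hp hq =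
      vcomp (.cons φ (.single ψ) hP rfl) (idV e) hp' hq' := by
    intro p q hp hq hp' hq'
    refine (vcomp_assoc' (.cons (.single φ) (idV e)
      (.cons (.single ψ) (idV e) (.nil h e) H.append_nil.symm rfl rfl) hP rfl rfl)
      (idV (𝟙 N)) (Category.comp_id _) (Category.comp_id _) hp hq hp' hq').trans ?_
    exact congrArg (fun t => vcomp _ t hp' hq') (vcomp_idV₂ e (𝟙 N) _)
  exact (left _ _ rfl rfl rfl rfl).trans (right _ _ rfl rfl).symm

end Basic

/-! ## Functors -/

/-- Morphisms of augmented virtual graphs that are functorial on vertical morphisms. -/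
structure GraphFunctor.{w₁, x₁, v₁, u₁, w₂, x₂, v₂, u₂}
    (𝒦 : Type u₁) [AugVirtGraph.{w₁, x₁, v₁} 𝒦] (ℒ : Type u₂) [AugVirtGraph.{w₂, x₂, v₂} ℒ]
    extends 𝒦 ⥤ ℒ where
  mapHor : ∀ {A B : 𝒦}, HorData.Hor A B → HorData.Hor (obj A) (obj B)
  mapCell : ∀ {A B C D : 𝒦} {f : A ⟶ C} {J : HPath A B} {g : B ⟶ D} {L : HTgt C D},
    Cell f J g L → Cell (map f) (J.map obj mapHor) (map g) (L.map obj mapHor)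

section GraphFunctor

universe w₁ x₁ v₁ u₁ w₂ x₂ v₂ u₂
variable {𝒦 : Type u₁} [AugVirtGraph.{w₁, x₁, v₁} 𝒦] {ℒ : Type u₂} [AugVirtGraph.{w₂, x₂, v₂} ℒ]

/-- The image of a path of horizontal morphisms. -/
abbrev GraphFunctor.mapPath (F : GraphFunctor 𝒦 ℒ) {A B : 𝒦} (J : HPath A B) :
    HPath (F.obj A) (F.obj B) :=
  J.map F.obj F.mapHor

/-- The image of a path of cells. -/
def GraphFunctor.mapCellPath (F : GraphFunctor 𝒦 ℒ) {A B C D : 𝒦} {f : A ⟶ C} {g : B ⟶ D}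
    {J : HPath A B} {K : HPath C D} :
    CellPath f J g K → CellPath (F.map f) (F.mapPath J) (F.map g) (F.mapPath K)
  | .nil f => .nil (F.map f)
  | .cons φ Φ hP hQ => .cons (F.mapCell φ) (F.mapCellPath Φ)
      (by rw [hP, GraphFunctor.mapPath, HPath.map_append])
      (by rw [hQ, GraphFunctor.mapPath, HPath.map_append, HTgt.toPath_map])

end GraphFunctor

/-- Functors of augmented virtual double categories. -/
structure AVDFunctor.{w₁, x₁, v₁, u₁, w₂, x₂, v₂, u₂}
    (𝒦 : Type u₁) [AugVirtDblCat.{w₁, x₁, v₁} 𝒦] (ℒ : Type u₂) [AugVirtDblCat.{w₂, x₂, v₂} ℒ]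
    extends GraphFunctor 𝒦 ℒ where
  map_idH : ∀ {A B : 𝒦} (J : HorData.Hor A B),
    mapCell (idH J) = copy (idH (mapHor J)) (map_id A).symm (map_id B).symm
  map_idV : ∀ {A C : 𝒦} (f : A ⟶ C), mapCell (idV f) = idV (map f)
  map_vcomp : ∀ {A B C D E G : 𝒦} {f : A ⟶ C} {J : HPath A B} {g : B ⟶ D} {K : HPath C D}
    {h : C ⟶ E} {k : D ⟶ G} {L : HTgt E G} (Φ : CellPath f J g K) (ψ : Cell h K k L),
    mapCell (vcomp Φ ψ rfl rfl) =
      vcomp (toGraphFunctor.mapCellPath Φ) (mapCell ψ) (map_comp f h).symm (map_comp g k).symm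

section Notions

universe w x v u
variable {𝒦 : Type u} [AugVirtDblCat.{w, x, v} 𝒦]

/-! ## Cartesian cells, restrictions, units -/

/-- A cell `ψ`, whose horizontal source is a path `S` of length at most one, is cartesian if any
cell `χ` with vertical boundaries `h ≫ f` and `k ≫ g` and the same horizontal target factors
uniquely through `ψ`. -/
def IsCartesian {A B C D : 𝒦} {f : A ⟶ C} (S : HTgt A B) {g : B ⟶ D} {L : HTgt C D}
    (ψ : Cell f S.toPath g L) : Prop :=
  ∀ {X Y : 𝒦} (h : X ⟶ A) (k : Y ⟶ B) (H : HPath X Y) (χ : Cell (h ≫ f) H (k ≫ g) L),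
    ∃! φ : Cell h H k S, vcomp (.single φ) ψ rfl rfl = χ

/-- The restriction `L(f, g)`: a horizontal morphism with a cartesian cell to `L`. It is a unary
restriction if `L` is a horizontal morphism, and a nullary one if `L` is empty. -/
structure Restriction {A B C D : 𝒦} (f : A ⟶ C) (L : HTgt C D) (g : B ⟶ D) where
  hor : HorData.Hor A B
  cell : Cell f (HTgt.single hor).toPath g L
  cart : IsCartesian (.single hor) cell

/-- An object is unital if its horizontal unit, the restriction `A(id, id)`, exists. -/
def Unital (A : 𝒦) : Prop :=
  Nonempty (Restriction (𝟙 A) (.nil A) (𝟙 A))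

/-- The companion `f_* = C(f, id)`. -/
abbrev Companion {A C : 𝒦} (f : A ⟶ C) :=
  Restriction f (.nil C) (𝟙 C)

/-! ## Left Kan extensions and Yoneda morphisms -/

/-- The nullary cell `η` is left Kan: it defines `l` as the left Kan extension of `d` along `J`. -/
def LeftKan {A B M : 𝒦} {d : A ⟶ M} {J : HPath A B} {l : B ⟶ M} (η : Cell d J l (.nil M)) :
    Prop :=
  ∀ {C : 𝒦} (H : HPath B C) (k : C ⟶ M) (φ : Cell d (J.append H) k (.nil M)),
    ∃! φ' : Cell l H k (.nil M), hcomp η φ' rfl = φ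

/-- A vertical morphism `f : A ⟶ M` is dense if every cartesian nullary cell
`J ⇒ M` with vertical source `f` is left Kan. -/
def Dense {A M : 𝒦} (f : A ⟶ M) : Prop :=
  ∀ {B : 𝒦} (J : HorData.Hor A B) (l : B ⟶ M) (η : Cell f (HTgt.single J).toPath l (.nil M)),
    IsCartesian (.single J) η → LeftKan η

/-- Yoneda morphisms: dense morphisms that satisfy the Yoneda axiom. -/
structure IsYoneda {A P : 𝒦} (y : A ⟶ P) : Prop where
  dense : Dense y
  yoneda : ∀ {B : 𝒦} (J : HorData.Hor A B),
    ∃ (l : B ⟶ P) (η : Cell y (HTgt.single J).toPath l (.nil P)), IsCartesian (.single J) η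

/-! ## Right cocartesian paths of cells -/

/-- Every nullary cell factors uniquely through the path of cells. -/
def WeaklyNullaryCocartesian {A B C D : 𝒦} {f : A ⟶ C} {J : HPath A B} {g : B ⟶ D}
    {K : HPath C D} (Φ : CellPath f J g K) : Prop :=
  ∀ {X : 𝒦} (h : C ⟶ X) (k : D ⟶ X) (χ : Cell (f ≫ h) J (g ≫ k) (.nil X)),
    ∃! χ' : Cell h K k (.nil X), vcomp Φ χ' rfl rfl = χ

/-- Every unary cell factors uniquely through the path of cells. -/
def WeaklyUnaryCocartesian {A B C D : 𝒦} {f : A ⟶ C} {J : HPath A B} {g : B ⟶ D}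
    {K : HPath C D} (Φ : CellPath f J g K) : Prop :=
  ∀ {X Y : 𝒦} (h : C ⟶ X) (k : D ⟶ Y) (L : HorData.Hor X Y)
    (χ : Cell (f ≫ h) J (g ≫ k) (.single L)),
    ∃! χ' : Cell h K k (.single L), vcomp Φ χ' rfl rfl = χ

/-- `Φ` is weakly nullary-cocartesian, and so is `Φ ⌢ (cart, id, …, id)` for every nonempty path
`(K₁, K₂, …)` such that the restriction of `K₁` along the vertical target of `Φ` exists. -/
def RightNullaryCocartesian {A B C D : 𝒦} {f : A ⟶ C} {J : HPath A B} {g : B ⟶ D}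
    {K : HPath C D} (Φ : CellPath f J g K) : Prop :=
  WeaklyNullaryCocartesian Φ ∧
  ∀ {Y Z : 𝒦} (K₁ : HorData.Hor D Y) (Ks : HPath Y Z) (r : Restriction g (.single K₁) (𝟙 Y)),
    WeaklyNullaryCocartesian (Φ.append (.cons r.cell (idPath Ks) rfl rfl))

/-- The unary variant of `RightNullaryCocartesian`. -/
def RightUnaryCocartesian {A B C D : 𝒦} {f : A ⟶ C} {J : HPath A B} {g : B ⟶ D}
    {K : HPath C D} (Φ : CellPath f J g K) : Prop :=
  WeaklyUnaryCocartesian Φ ∧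
  ∀ {Y Z : 𝒦} (K₁ : HorData.Hor D Y) (Ks : HPath Y Z) (r : Restriction g (.single K₁) (𝟙 Y)),
    WeaklyUnaryCocartesian (Φ.append (.cons r.cell (idPath Ks) rfl rfl))

/-- Right cocartesian paths of cells. -/
def RightCocartesian {A B C D : 𝒦} {f : A ⟶ C} {J : HPath A B} {g : B ⟶ D}
    {K : HPath C D} (Φ : CellPath f J g K) : Prop :=
  RightNullaryCocartesian Φ ∧ RightUnaryCocartesian Φ

/-- The horizontal cell `φ : (H₁, …, Hₙ₋₁, Hₙ) ⇒ J` is pointwise right cocartesian: it is right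
cocartesian and, for every `f` such that the restriction `Hₙ(id, f)` exists, the restriction
`J(id, f)` exists and the factorisation `φ' : (H₁, …, Hₙ(id, f)) ⇒ J(id, f)` of
`φ ∘ (id, …, id, cart)` through `J(id, f)` is right cocartesian. -/
def PointwiseRightCocartesian {A E B : 𝒦} (H' : HPath A E) (Hn : HorData.Hor E B)
    (J : HorData.Hor A B)
    (φ : Cell (𝟙 A) (H'.append (HTgt.single Hn).toPath) (𝟙 B) (.single J)) : Prop :=
  RightCocartesian (.single φ) ∧
  ∀ {Y : 𝒦} (f : Y ⟶ B) (r : Restriction (𝟙 E) (.single Hn) f),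
    Nonempty (Restriction (𝟙 A) (.single J) f) ∧
    ∀ (s : Restriction (𝟙 A) (.single J) f)
      (φ' : Cell (𝟙 A) (H'.append (HTgt.single r.hor).toPath) (𝟙 Y) (.single s.hor)),
      vcomp (.single φ') s.cell (Category.comp_id (𝟙 A)) (Category.id_comp f) =
        vcomp ((idPath H').append (.single r.cell)) φ
          (Category.comp_id (𝟙 A)) (Category.comp_id f) →
      RightCocartesian (.single φ')

/-! ## Slice categories -/

/-- Objects of `𝒦 / X`: vertical morphisms into `X`. -/
structure VSlice (X : 𝒦) where
  pt : 𝒦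
  mor : pt ⟶ X

/-- Morphisms of `𝒦 / X`: a path of horizontal morphisms together with a nullary cell. -/
@[ext] structure VSlice.Hom {X : 𝒦} (a b : VSlice X) where
  path : HPath a.pt b.pt
  cell : Cell a.mor path b.mor (.nil X)

instance (X : 𝒦) : Category (VSlice X) where
  Hom := VSlice.Hom
  id a := ⟨.nil a.pt, idV a.mor⟩
  comp φ ψ := ⟨φ.path.append ψ.path, hcomp φ.cell ψ.cell rfl⟩
  id_comp φ := congrArg (VSlice.Hom.mk φ.path) (idV_hcomp φ.cell)
  comp_id {a b} φ := by
    have : ∀ {P : HPath a.pt b.pt} (h : P = φ.path) (hP : P = φ.path.append (.nil b.pt)),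
        (⟨P, hcomp φ.cell (idV b.mor) hP⟩ : VSlice.Hom a b) = φ := by
      intro P h hP
      subst h
      exact congrArg (VSlice.Hom.mk φ.path) (hcomp_idV φ.cell)
    exact this φ.path.append_nil rfl
  assoc {a b c d} φ ψ χ := by
    have : ∀ {P : HPath a.pt d.pt} (h : (φ.path.append ψ.path).append χ.path = P)
        (hP : P = φ.path.append (ψ.path.append χ.path)),
        (⟨_, hcomp (hcomp φ.cell ψ.cell rfl) χ.cell rfl⟩ : VSlice.Hom a d) =
          ⟨P, hcomp φ.cell (hcomp ψ.cell χ.cell rfl) hP⟩ := by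
      intro P h hP
      subst h
      exact congrArg (VSlice.Hom.mk _) (hcomp_assoc _ _ _ _ _ _ _)
    exact this (HPath.append_assoc _ _ _) rfl

end Notions

section Functor

universe w₁ x₁ v₁ u₁ w₂ x₂ v₂ u₂
variable {𝒦 : Type u₁} [AugVirtDblCat.{w₁, x₁, v₁} 𝒦]
  {ℒ : Type u₂} [AugVirtDblCat.{w₂, x₂, v₂} ℒ]

/-- Objects of `F / X`: pairs of an object `A` and a vertical morphism `F A ⟶ X`. -/
structure FSlice (F : AVDFunctor 𝒦 ℒ) (X : ℒ) where
  pt : 𝒦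
  mor : F.obj pt ⟶ X

/-- Morphisms of `F / X`: a path `H` of horizontal morphisms in `𝒦` together with a nullary cell
`F H ⇒ X` in `ℒ`. -/
@[ext] structure FSlice.Hom {F : AVDFunctor 𝒦 ℒ} {X : ℒ} (a b : FSlice F X) where
  path : HPath a.pt b.pt
  cell : Cell a.mor (F.mapPath path) b.mor (.nil X)

instance (F : AVDFunctor 𝒦 ℒ) (X : ℒ) : Category (FSlice F X) where
  Hom := FSlice.Hom
  id a := ⟨.nil a.pt, idV a.mor⟩
  comp φ ψ := ⟨φ.path.append ψ.path, hcomp φ.cell ψ.cell (HPath.map_append _ _ _ _)⟩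
  id_comp φ := congrArg (FSlice.Hom.mk φ.path) (idV_hcomp φ.cell)
  comp_id {a b} φ := by
    have : ∀ {P : HPath a.pt b.pt} (h : P = φ.path)
        (hP : F.mapPath P = (F.mapPath φ.path).append (.nil (F.obj b.pt))),
        (⟨P, hcomp φ.cell (idV b.mor) hP⟩ : FSlice.Hom a b) = φ := by
      intro P h hP
      subst h
      exact congrArg (FSlice.Hom.mk φ.path) (hcomp_idV φ.cell)
    exact this φ.path.append_nil (HPath.map_append _ _ _ _)
  assoc {a b c d} φ ψ χ := by
    have : ∀ {P : HPath a.pt d.pt} (h : (φ.path.append ψ.path).append χ.path = P)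
        (hP : F.mapPath P = (F.mapPath φ.path).append (F.mapPath (ψ.path.append χ.path))),
        (⟨_, hcomp (hcomp φ.cell ψ.cell (HPath.map_append _ _ _ _)) χ.cell
          (HPath.map_append _ _ _ _)⟩ : FSlice.Hom a d) =
          ⟨P, hcomp φ.cell (hcomp ψ.cell χ.cell (HPath.map_append _ _ _ _)) hP⟩ := by
      intro P h hP
      subst h
      exact congrArg (FSlice.Hom.mk _) (hcomp_assoc _ _ _ _ _ _ _)
    exact this (HPath.append_assoc _ _ _) (HPath.map_append _ _ _ _)

theorem AVDFunctor.map_vcomp' (F : AVDFunctor 𝒦 ℒ) {A B C D E G : 𝒦} {f : A ⟶ C} {J : HPath A B}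
    {g : B ⟶ D} {K : HPath C D} {h : C ⟶ E} {k : D ⟶ G} {L : HTgt E G} {p : A ⟶ E} {q : B ⟶ G}
    (Φ : CellPath f J g K) (ψ : Cell h K k L) (hp : f ≫ h = p) (hq : g ≫ k = q) :
    F.mapCell (vcomp Φ ψ hp hq) = vcomp (F.mapCellPath Φ) (F.mapCell ψ)
      (by rw [← hp, F.map_comp]) (by rw [← hq, F.map_comp]) := by
  subst hp hq
  exact F.map_vcomp Φ ψ

theorem AVDFunctor.map_hcomp (F : AVDFunctor 𝒦 ℒ) {A B C M : 𝒦} {f : A ⟶ M} {g : B ⟶ M}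
    {h : C ⟶ M} {J : HPath A B} {H : HPath B C} {P : HPath A C} (φ : Cell f J g (.nil M))
    (ψ : Cell g H h (.nil M)) (hP : P = J.append H)
    (hP' : F.mapPath P = (F.mapPath J).append (F.mapPath H)) :
    F.mapCell (hcomp φ ψ hP) =
      hcomp (M := F.obj M) (F.mapCell φ) (F.mapCell ψ) hP' := by
  refine (F.map_vcomp' _ _ _ _).trans ?_
  have key : ∀ {a : F.obj M ⟶ F.obj M} (ha : a = 𝟙 _) (hp : F.map f ≫ a = F.map f)
      (hq : F.map h ≫ a = F.map h),
      vcomp (.cons (F.mapCell φ) (.single (F.mapCell ψ)) hP' rfl) (idV a) hp hq =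
        hcomp (M := F.obj M) (F.mapCell φ) (F.mapCell ψ) hP' := by
    intro a ha hp hq
    subst ha
    rfl
  refine Eq.trans ?_ (key (F.map_id M) (by simp) (by simp))
  exact congrArg (fun t => vcomp (.cons (F.mapCell φ) (.single (F.mapCell ψ)) hP' rfl) t _ _)
    (F.map_idV (𝟙 M))

/-- The functor `e ∘ F- : 𝒦 / C' ⥤ F / C` given by a vertical morphism `e : F C' ⟶ C`. -/
def postcomp (F : AVDFunctor 𝒦 ℒ) {C' : 𝒦} {C : ℒ} (e : F.obj C' ⟶ C) :
    VSlice C' ⥤ FSlice F C where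
  obj a := ⟨a.pt, F.map a.mor ≫ e⟩
  map φ := ⟨φ.path, whisker (M := F.obj C') (F.mapCell φ.cell) e⟩
  map_id a := by
    refine congrArg (FSlice.Hom.mk (F := F) (X := C)
      (a := ⟨a.pt, F.map a.mor ≫ e⟩) (b := ⟨a.pt, F.map a.mor ≫ e⟩) (.nil a.pt)) ?_
    exact (congrArg (fun t => whisker (M := F.obj C') t e) (F.map_idV a.mor)).trans
      (whisker_idV _ _)
  map_comp {a b c} φ ψ := by
    refine congrArg (FSlice.Hom.mk (F := F) (X := C)
      (a := ⟨a.pt, F.map a.mor ≫ e⟩) (b := ⟨c.pt, F.map c.mor ≫ e⟩) (φ.path.append ψ.path)) ?_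
    exact (congrArg (fun t => whisker (M := F.obj C') t e)
      (F.map_hcomp φ.cell ψ.cell rfl (HPath.map_append _ _ _ _))).trans (whisker_hcomp _ _ _ _)

/-- `e : F C' ⟶ C` is locally universal from `F` to `C`. -/
def LocallyUniversalV (F : AVDFunctor 𝒦 ℒ) {C' : 𝒦} {C : ℒ} (e : F.obj C' ⟶ C) : Prop :=
  (postcomp F e).Full ∧ (postcomp F e).Faithful

/-- `e : F C' ⟶ C` is universal from `F` to `C` relative to the full subcategory `𝒥` of `F / C`:
it is locally universal and `e ∘ F-` factors through `𝒥` as an equivalence `𝒦 / C' ≃ 𝒥`. -/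
def UniversalRelativeTo (F : AVDFunctor 𝒦 ℒ) {C' : 𝒦} {C : ℒ} (e : F.obj C' ⟶ C)
    (𝒥 : ObjectProperty (FSlice F C)) : Prop :=
  LocallyUniversalV F e ∧
  ∃ h : ∀ a, 𝒥 ((postcomp F e).obj a), (𝒥.lift (postcomp F e) h).IsEquivalence

/-! ## Locally universal horizontal morphisms -/

/-- The adjunct `J♭`: a pointwise right composite of `(ι, F J)`. -/
structure Adjunct (F : AVDFunctor 𝒦 ℒ) {A : ℒ} {A' : 𝒦} (ι : HorData.Hor A (F.obj A')) {B : 𝒦}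
    (J : HorData.Hor A' B) where
  hor : HorData.Hor A (F.obj B)
  cell : Cell (𝟙 A) (.cons ι (.cons (F.mapHor J) (.nil (F.obj B)))) (𝟙 (F.obj B)) (.single hor)
  cocart : PointwiseRightCocartesian (HTgt.single ι).toPath (F.mapHor J) hor cell

/-- `ι : A ⇸ F A'` is locally universal from `A` to `F`. -/
structure LocallyUniversalH (F : AVDFunctor 𝒦 ℒ) {A : ℒ} {A' : 𝒦}
    (ι : HorData.Hor A (F.obj A')) : Prop where
  adjunct : ∀ {B : 𝒦} (J : HorData.Hor A' B), Nonempty (Adjunct F ι J)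
  restriction : ∀ {X : 𝒦} (h : X ⟶ A'), Nonempty (Restriction (𝟙 A) (.single ι) (F.map h))
  bijective : ∀ {X Y B : 𝒦} (h : X ⟶ A') (k : Y ⟶ B) (H : HPath X Y) (J : HorData.Hor A' B)
    (Jb : Adjunct F ι J) (r : Restriction (𝟙 A) (.single ι) (F.map h)),
    Function.Bijective (fun φ : Cell h H k (.single J) =>
      (vcomp (.cons r.cell (.single (F.mapCell φ)) rfl rfl) Jb.cell
        (Category.comp_id (𝟙 A)) (Category.comp_id (F.map k)) :
        Cell (𝟙 A) ((HTgt.single r.hor).toPath.append (F.mapPath H)) (F.map k) (.single Jb.hor)))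

/-- The full subcategory of `F / P` of the `ι`-small morphisms: those `f : F B ⟶ P` that are the
left Kan extension of `y` along `J♭` for some `J : A' ⇸ B`. -/
def IotaSmall (F : AVDFunctor 𝒦 ℒ) {A P : ℒ} {A' : 𝒦} (ι : HorData.Hor A (F.obj A'))
    (y : A ⟶ P) : ObjectProperty (FSlice F P) := fun f =>
  ∃ (J : HorData.Hor A' f.pt) (Jb : Adjunct F ι J)
    (η : Cell y (HTgt.single Jb.hor).toPath f.mor (.nil P)), LeftKan η

end Functor

end AVDC

open AVDC
open AVDC.AugVirtGraph (Cell)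

universe w₁ x₁ v₁ u₁ w₂ x₂ v₂ u₂

open AVDC.AugVirtComp (vcomp idH idV)

namespace AVDC

section Calculus

variable {𝒦 : Type u₁} [AugVirtDblCat.{w₁, x₁, v₁} 𝒦]

/-- `χ ∘ (ψ ∘ Φ) = (χ ∘ ψ) ∘ Φ` -/
theorem vcomp_single_vcomp {A B C D E G X Y : 𝒦} {f : A ⟶ C} {J : HPath A B} {g : B ⟶ D}
    {K : HPath C D} {h : C ⟶ E} {k : D ⟶ G} {L : HTgt E G} {l : E ⟶ X} {r : G ⟶ Y} {N : HTgt X Y}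
    (Φ : CellPath f J g K) (ψ : Cell h K k L) (χ : Cell l L.toPath r N)
    {p : A ⟶ E} {q : B ⟶ G} (hp : f ≫ h = p) (hq : g ≫ k = q)
    {p' : A ⟶ X} {q' : B ⟶ Y} (hp' : p ≫ l = p') (hq' : q ≫ r = q')
    {a : C ⟶ X} {b : D ⟶ Y} (ha : h ≫ l = a) (hb : k ≫ r = b)
    (hs : f ≫ a = p') (ht : g ≫ b = q') :
    vcomp (.single (vcomp Φ ψ hp hq)) χ hp' hq' = vcomp Φ (vcomp (.single ψ) χ ha hb) hs ht := by
  subst hp hq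
  refine (vcomp_assoc' (.cons Φ ψ (.nil g k) J.append_nil.symm K.append_nil.symm
    L.toPath.append_nil.symm) χ ha hb hp' hq' hs ht).trans ?_
  exact congrArg (fun t => vcomp t _ hs ht) (CellPath.appendEq_nil Φ _ _)

/-- `χ ∘ (ψ₁ ∘ Φ₁, ψ₂ ∘ Φ₂) = (χ ∘ (ψ₁, ψ₂)) ∘ (Φ₁ ⌢ Φ₂)` -/
theorem vcomp_pair_vcomp {A B B' C D D' E G G' X Y : 𝒦} {f : A ⟶ C} {h : C ⟶ E} {g : B ⟶ D}
    {k : D ⟶ G} {g' : B' ⟶ D'} {k' : D' ⟶ G'} {J : HPath A B} {K : HPath C D} {L : HTgt E G}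
    {J' : HPath B B'} {K' : HPath D D'} {L' : HTgt G G'} {P : HPath A B'} {Q : HPath C D'}
    {R : HPath E G'} {l : E ⟶ X} {r : G' ⟶ Y} {N : HTgt X Y}
    (Φ : CellPath f J g K) (ψ : Cell h K k L) (Φ' : CellPath g J' g' K') (ψ' : Cell k K' k' L')
    (χ : Cell l R r N) (hP : P = J.append J') (hQ : Q = K.append K')
    (hR : R = L.toPath.append L'.toPath)
    {p : A ⟶ E} {m : B ⟶ G} {q : B' ⟶ G'} (hp : f ≫ h = p) (hm : g ≫ k = m) (hq : g' ≫ k' = q)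
    {p' : A ⟶ X} {q' : B' ⟶ Y} (hp' : p ≫ l = p') (hq' : q ≫ r = q')
    {a : C ⟶ X} {b : D' ⟶ Y} (ha : h ≫ l = a) (hb : k' ≫ r = b)
    (hs : f ≫ a = p') (ht : g' ≫ b = q') :
    vcomp (.cons (vcomp Φ ψ hp hm) (.single (vcomp Φ' ψ' hm hq)) hP hR) χ hp' hq' =
      vcomp (Φ.appendEq Φ' hP hQ) (vcomp (.cons ψ (.single ψ') hQ hR) χ ha hb) hs ht := by
  subst hp hq hm
  refine (vcomp_assoc' (.cons Φ ψ (.cons Φ' ψ' (.nil g' k') J'.append_nil.symm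
    K'.append_nil.symm L'.toPath.append_nil.symm) hP hQ hR) χ ha hb hp' hq' hs ht).trans ?_
  exact congrArg (fun t => vcomp (Φ.appendEq t hP hQ) _ hs ht) (CellPath.appendEq_nil Φ' _ _)

theorem vcomp_idPath {A B C D : 𝒦} {f : A ⟶ C} {J : HPath A B} {g : B ⟶ D} {L : HTgt C D}
    (φ : Cell f J g L) (hp : 𝟙 A ≫ f = f) (hq : 𝟙 B ≫ g = g) : vcomp (idPath J) φ hp hq = φ :=
  AugVirtDblCat.vcomp_id φ

theorem vcomp_single_idH {A B C D : 𝒦} {f : A ⟶ C} {J : HorData.Hor A B} {g : B ⟶ D}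
    {L : HTgt C D} (φ : Cell f (HTgt.single J).toPath g L) (hp : 𝟙 A ≫ f = f)
    (hq : 𝟙 B ≫ g = g) : vcomp (.single (idH J)) φ hp hq = φ :=
  AugVirtDblCat.vcomp_id φ

theorem vcomp_nil_id {A C D : 𝒦} {f : A ⟶ C} {g : A ⟶ D} {L : HTgt C D}
    (φ : Cell f (.nil A) g L) (hp : 𝟙 A ≫ f = f) (hq : 𝟙 A ≫ g = g) :
    vcomp (.nil (𝟙 A)) φ hp hq = φ :=
  AugVirtDblCat.vcomp_id φ

theorem single_vcomp_idH {A B C D : 𝒦} {f : A ⟶ C} {J : HPath A B} {g : B ⟶ D}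
    {K : HorData.Hor C D} (φ : Cell f J g (.single K)) (hp : f ≫ 𝟙 C = f) (hq : g ≫ 𝟙 D = g) :
    vcomp (.single φ) (idH K) hp hq = φ :=
  AugVirtDblCat.idH_vcomp φ

theorem single_vcomp_idV {A B C : 𝒦} {f : A ⟶ C} {J : HPath A B} {g : B ⟶ C}
    (φ : Cell f J g (.nil C)) (hp : f ≫ 𝟙 C = f) (hq : g ≫ 𝟙 C = g) :
    vcomp (.single φ) (idV (𝟙 C)) hp hq = φ :=
  AugVirtDblCat.idV_vcomp φ

theorem vcomp_nil_idV {A C E : 𝒦} (f : A ⟶ C) (h : C ⟶ E) {p : A ⟶ E} (hp : f ≫ h = p) :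
    vcomp (.nil f) (idV h) hp hp = idV p :=
  (vcomp_insert' (.nil f) (.nil f) (idV h) hp hp).symm.trans (idV_idV' f h hp)

theorem vcomp_copy {A B C D E G : 𝒦} {f : A ⟶ C} {J : HPath A B} {g : B ⟶ D} {K : HPath C D}
    {h h' : C ⟶ E} {k k' : D ⟶ G} {L : HTgt E G} {p : A ⟶ E} {q : B ⟶ G}
    (Φ : CellPath f J g K) (ψ : Cell h K k L) (hh : h = h') (hk : k = k') (hp : f ≫ h' = p)
    (hq : g ≫ k' = q) :
    vcomp Φ (copy ψ hh hk) hp hq = vcomp Φ ψ (hh ▸ hp) (hk ▸ hq) := by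
  subst hh hk
  rfl

/-- Interchange of horizontal composition with vertical precomposition. -/
theorem vcomp_hcomp {A B C A' B' C' M : 𝒦} {a : A' ⟶ A} {b : B' ⟶ B} {c : C' ⟶ C} {f : A ⟶ M}
    {g : B ⟶ M} {h : C ⟶ M} {J : HPath A B} {H : HPath B C} {P : HPath A C} {J' : HPath A' B'}
    {H' : HPath B' C'} {P' : HPath A' C'} (Φ : CellPath a J' b J) (Ψ : CellPath b H' c H)
    (φ : Cell f J g (.nil M)) (ψ : Cell g H h (.nil M)) (hP : P = J.append H)
    (hP' : P' = J'.append H') {p q r : _ ⟶ M} (hp : a ≫ f = p) (hq : b ≫ g = q)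
    (hr : c ≫ h = r) :
    hcomp (vcomp Φ φ hp hq) (vcomp Ψ ψ hq hr) hP' =
      vcomp (Φ.appendEq Ψ hP' hP) (hcomp φ ψ hP) hp hr :=
  vcomp_pair_vcomp Φ φ Ψ ψ (idV (𝟙 M)) hP' hP rfl hp hq hr _ _ _ _ _ _

end Calculus

section Notions

variable {𝒦 : Type u₁} [AugVirtDblCat.{w₁, x₁, v₁} 𝒦]

theorem IsCartesian.existsUnique {A B C D : 𝒦} {f : A ⟶ C} {S : HTgt A B} {g : B ⟶ D}
    {L : HTgt C D} {ψ : Cell f S.toPath g L} (hψ : IsCartesian S ψ) {X Y : 𝒦} {h : X ⟶ A}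
    {k : Y ⟶ B} {H : HPath X Y} {p : X ⟶ C} {q : Y ⟶ D} (χ : Cell p H q L) (hp : h ≫ f = p)
    (hq : k ≫ g = q) : ∃! φ : Cell h H k S, vcomp (.single φ) ψ hp hq = χ := by
  subst hp hq
  exact hψ h k H χ

theorem IsCartesian.hom_ext {A B C D : 𝒦} {f : A ⟶ C} {S : HTgt A B} {g : B ⟶ D}
    {L : HTgt C D} {ψ : Cell f S.toPath g L} (hψ : IsCartesian S ψ) {X Y : 𝒦} {h : X ⟶ A}
    {k : Y ⟶ B} {H : HPath X Y} {p : X ⟶ C} {q : Y ⟶ D} {φ φ' : Cell h H k S} (hp : h ≫ f = p)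
    (hq : k ≫ g = q) (e : vcomp (.single φ) ψ hp hq = vcomp (.single φ') ψ hp hq) : φ = φ' :=
  (hψ.existsUnique _ hp hq).unique e rfl

theorem IsCartesian.copy {A B C D : 𝒦} {f f' : A ⟶ C} {S : HTgt A B} {g g' : B ⟶ D}
    {L : HTgt C D} {ψ : Cell f S.toPath g L} (hψ : IsCartesian S ψ) (hf : f = f') (hg : g = g') :
    IsCartesian S (copy ψ hf hg) := by
  subst hf hg
  exact hψ

theorem isCartesian_idH {A B : 𝒦} (J : HorData.Hor A B) : IsCartesian (.single J) (idH J) := by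
  have key : ∀ {X Y : 𝒦} {h : X ⟶ A} {k : Y ⟶ B} {H : HPath X Y} {p : X ⟶ A} {q : Y ⟶ B}
      (χ : Cell p H q (.single J)) (hp : h = p) (hq : k = q) (hp' : h ≫ 𝟙 A = p)
      (hq' : k ≫ 𝟙 B = q), ∃! φ : Cell h H k (.single J), vcomp (.single φ) (idH J) hp' hq' = χ := by
    intro X Y h k H p q χ hp hq hp' hq'
    subst hp hq
    exact ⟨χ, single_vcomp_idH χ _ _, fun φ hφ => (single_vcomp_idH φ _ _).symm.trans hφ⟩
  exact fun {_ _} h k H χ => key χ (Category.comp_id h).symm (Category.comp_id k).symm rfl rfl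

/-- Cartesian cells compose. -/
theorem IsCartesian.comp {A B C D E G : 𝒦} {f : A ⟶ C} {S : HTgt A B} {g : B ⟶ D}
    {T : HTgt C D} {h : C ⟶ E} {k : D ⟶ G} {L : HTgt E G} {φ : Cell f S.toPath g T}
    {ψ : Cell h T.toPath k L} (hφ : IsCartesian S φ) (hψ : IsCartesian T ψ) {p : A ⟶ E}
    {q : B ⟶ G} (hp : f ≫ h = p) (hq : g ≫ k = q) :
    IsCartesian S (vcomp (.single φ) ψ hp hq) := by
  intro X Y a b H χ
  have e : ∀ ξ : Cell a H b S, vcomp (.single ξ) (vcomp (.single φ) ψ hp hq) rfl rfl =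
      vcomp (.single (vcomp (.single ξ) φ rfl rfl)) ψ (by simp [← hp]) (by simp [← hq]) :=
    fun ξ => (vcomp_single_vcomp _ _ _ _ _ _ _ _ _ _ _).symm
  obtain ⟨ζ, hζ, -⟩ := hψ.existsUnique (h := a ≫ f) (k := b ≫ g) χ (by simp [← hp])
    (by simp [← hq])
  obtain ⟨ξ, hξ, -⟩ := hφ a b H ζ
  refine ⟨ξ, by dsimp only; rw [e, hξ, hζ], fun ξ' hξ' => ?_⟩
  dsimp only at hξ'
  rw [e] at hξ'
  refine hφ.hom_ext rfl rfl (Eq.trans ?_ hξ.symm)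
  exact hψ.hom_ext _ _ (hξ'.trans hζ.symm)

/-- If `ψ` and `ψ ∘ φ` are cartesian then so is `φ`. -/
theorem IsCartesian.of_comp {A B C D E G : 𝒦} {f : A ⟶ C} {S : HTgt A B} {g : B ⟶ D}
    {T : HTgt C D} {h : C ⟶ E} {k : D ⟶ G} {L : HTgt E G} {φ : Cell f S.toPath g T}
    {ψ : Cell h T.toPath k L} {p : A ⟶ E} {q : B ⟶ G} {hp : f ≫ h = p} {hq : g ≫ k = q}
    (hφψ : IsCartesian S (vcomp (.single φ) ψ hp hq)) (hψ : IsCartesian T ψ) :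
    IsCartesian S φ := by
  intro X Y a b H χ
  have hp' : (a ≫ f) ≫ h = a ≫ p := by simp [← hp]
  have hq' : (b ≫ g) ≫ k = b ≫ q := by simp [← hq]
  have e : ∀ ξ : Cell a H b S, vcomp (.single ξ) (vcomp (.single φ) ψ hp hq) rfl rfl =
      vcomp (.single (vcomp (.single ξ) φ rfl rfl)) ψ hp' hq' :=
    fun ξ => (vcomp_single_vcomp _ _ _ _ _ _ _ _ _ _ _).symm
  obtain ⟨ξ, hξ, hu⟩ := hφψ a b H (vcomp (.single χ) ψ hp' hq')
  rw [e] at hξ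
  refine ⟨ξ, hψ.hom_ext _ _ hξ, fun ξ' hξ' => hu ξ' ?_⟩
  dsimp only at hξ' ⊢
  rw [e, hξ']

/-- Invertible horizontal cells are cartesian. -/
theorem isCartesian_of_inverse {A B : 𝒦} {J K : HorData.Hor A B}
    {u : Cell (𝟙 A) (HTgt.single J).toPath (𝟙 B) (.single K)}
    {v : Cell (𝟙 A) (HTgt.single K).toPath (𝟙 B) (.single J)}
    (huv : vcomp (.single u) v (Category.comp_id _) (Category.comp_id _) = idH J)
    (hvu : vcomp (.single v) u (Category.comp_id _) (Category.comp_id _) = idH K) :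
    IsCartesian (.single J) u := by
  have key : ∀ {X Y : 𝒦} {h : X ⟶ A} {k : Y ⟶ B} {H : HPath X Y} {p : X ⟶ A} {q : Y ⟶ B}
      (χ : Cell p H q (.single K)) (hp : h = p) (hq : k = q) (hp' : h ≫ 𝟙 A = p)
      (hq' : k ≫ 𝟙 B = q), ∃! φ : Cell h H k (.single J), vcomp (.single φ) u hp' hq' = χ := by
    intro X Y h k H p q χ hp hq hp' hq'
    subst hp hq
    refine ⟨vcomp (.single χ) v hp' hq', ?_, fun φ hφ => ?_⟩
    · refine (vcomp_single_vcomp _ _ _ _ _ _ _ (Category.comp_id _) (Category.comp_id _) hp'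
        hq').trans ?_
      rw [hvu, single_vcomp_idH]
    · subst hφ
      refine Eq.trans ?_ (vcomp_single_vcomp _ _ _ _ _ _ _ (Category.comp_id _)
        (Category.comp_id _) hp' hq').symm
      rw [huv, single_vcomp_idH]
  exact fun {_ _} h k H χ => key χ (Category.comp_id h).symm (Category.comp_id k).symm rfl rfl

/-- The horizontal composite of a cartesian nullary cell with an invertible vertical cell is
cartesian. -/
theorem IsCartesian.hcomp {A B M : 𝒦} {f : A ⟶ M} {S : HTgt A B} {g g' : B ⟶ M}
    {ψ : Cell f S.toPath g (.nil M)} (hψ : IsCartesian S ψ) {θ : Cell g (.nil B) g' (.nil M)}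
    {θ' : Cell g' (.nil B) g (.nil M)} (h₁ : hcomp θ θ' rfl = idV g)
    (h₂ : hcomp θ' θ rfl = idV g') :
    IsCartesian S (hcomp ψ θ S.toPath.append_nil.symm) := by
  intro X Y a b H χ
  have e : ∀ ξ : Cell a H b S, vcomp (.single ξ) (AVDC.hcomp ψ θ S.toPath.append_nil.symm) rfl rfl =
      AVDC.hcomp (vcomp (.single ξ) ψ rfl rfl) (vcomp (.nil b) θ rfl rfl) H.append_nil.symm := by
    intro ξ
    refine Eq.trans ?_ (vcomp_hcomp (.single ξ) (.nil b) ψ θ S.toPath.append_nil.symm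
      H.append_nil.symm rfl rfl rfl).symm
    rw [CellPath.appendEq_nil]
  have e₁ : AVDC.hcomp (vcomp (.nil b) θ rfl rfl) (vcomp (.nil b) θ' rfl rfl) rfl =
      idV (b ≫ g) := by
    refine (vcomp_hcomp (.nil b) (.nil b) θ θ' rfl rfl rfl rfl rfl).trans ?_
    rw [h₁]
    exact vcomp_nil_idV _ _ _
  have e₂ : AVDC.hcomp (vcomp (.nil b) θ' rfl rfl) (vcomp (.nil b) θ rfl rfl) rfl =
      idV (b ≫ g') := by
    refine (vcomp_hcomp (.nil b) (.nil b) θ' θ rfl rfl rfl rfl rfl).trans ?_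
    rw [h₂]
    exact vcomp_nil_idV _ _ _
  obtain ⟨ξ, hξ, hu⟩ := hψ a b H (AVDC.hcomp χ (vcomp (.nil b) θ' rfl rfl) H.append_nil.symm)
  refine ⟨ξ, ?_, fun ξ' hξ' => hu ξ' ?_⟩
  · dsimp only
    rw [e, hξ, hcomp_assoc _ _ _ _ _ rfl H.append_nil.symm, e₂, hcomp_idV]
  · dsimp only at hξ' ⊢
    rw [← hξ', e, hcomp_assoc _ _ _ _ _ rfl H.append_nil.symm, e₁, hcomp_idV]

theorem WeaklyNullaryCocartesian.existsUnique {A B C D : 𝒦} {f : A ⟶ C} {J : HPath A B}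
    {g : B ⟶ D} {K : HPath C D} {Φ : CellPath f J g K} (hΦ : WeaklyNullaryCocartesian Φ) {X : 𝒦}
    {h : C ⟶ X} {k : D ⟶ X} {p : A ⟶ X} {q : B ⟶ X} (χ : Cell p J q (.nil X)) (hp : f ≫ h = p)
    (hq : g ≫ k = q) : ∃! χ' : Cell h K k (.nil X), vcomp Φ χ' hp hq = χ := by
  subst hp hq
  exact hΦ h k χ

theorem WeaklyUnaryCocartesian.existsUnique {A B C D : 𝒦} {f : A ⟶ C} {J : HPath A B}
    {g : B ⟶ D} {K : HPath C D} {Φ : CellPath f J g K} (hΦ : WeaklyUnaryCocartesian Φ) {X Y : 𝒦}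
    {h : C ⟶ X} {k : D ⟶ Y} {L : HorData.Hor X Y} {p : A ⟶ X} {q : B ⟶ Y}
    (χ : Cell p J q (.single L)) (hp : f ≫ h = p) (hq : g ≫ k = q) :
    ∃! χ' : Cell h K k (.single L), vcomp Φ χ' hp hq = χ := by
  subst hp hq
  exact hΦ h k L χ

/-- Two horizontal cells with the same source through which unary cells factor uniquely differ by
an invertible cell. -/
theorem WeaklyUnaryCocartesian.exists_iso {A B : 𝒦} {P : HPath A B} {J K : HorData.Hor A B}
    {φ : Cell (𝟙 A) P (𝟙 B) (.single J)} {ψ : Cell (𝟙 A) P (𝟙 B) (.single K)}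
    (hφ : WeaklyUnaryCocartesian (.single φ)) (hψ : WeaklyUnaryCocartesian (.single ψ)) :
    ∃ u : Cell (𝟙 A) (HTgt.single J).toPath (𝟙 B) (.single K), IsCartesian (.single J) u ∧
      vcomp (.single φ) u (Category.comp_id _) (Category.comp_id _) = ψ := by
  have i : ∀ X : 𝒦, 𝟙 X ≫ 𝟙 X = 𝟙 X := fun X => Category.comp_id _
  obtain ⟨u, hu, -⟩ := hφ.existsUnique ψ (i A) (i B)
  obtain ⟨v, hv, -⟩ := hψ.existsUnique φ (i A) (i B)
  refine ⟨u, isCartesian_of_inverse (v := v) ?_ ?_, hu⟩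
  · refine (hφ.existsUnique φ (i A) (i B)).unique ?_ (AugVirtDblCat.idH_vcomp φ)
    rw [← vcomp_single_vcomp _ _ _ (i A) (i B) (i A) (i B), hu, hv]
  · refine (hψ.existsUnique ψ (i A) (i B)).unique ?_ (AugVirtDblCat.idH_vcomp ψ)
    rw [← vcomp_single_vcomp _ _ _ (i A) (i B) (i A) (i B), hv, hu]

/-- Right cocartesian cells factor nullary cells with any further horizontal morphisms in their
source. -/
theorem RightNullaryCocartesian.append_idPath {A B : 𝒦} {E : 𝒦} {J₁ : HorData.Hor A E}
    {Js : HPath E B} {J : HorData.Hor A B}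
    {φ : Cell (𝟙 A) (.cons J₁ Js) (𝟙 B) (.single J)} (hφ : RightNullaryCocartesian (.single φ)) :
    ∀ {C : 𝒦} (H : HPath B C),
      WeaklyNullaryCocartesian ((CellPath.single φ).appendEq (idPath H) rfl rfl)
  | _, .nil _ => by
    have key : ∀ (P : HPath A B) (hP : P = .cons J₁ Js)
        (hP' : P = (HPath.cons J₁ Js).append (.nil B)),
        WeaklyNullaryCocartesian ((CellPath.single φ).appendEq (idPath (.nil B)) hP' rfl) := by
      intro P hP hP'
      subst hP
      have := CellPath.appendEq_nil (CellPath.single φ) hP' rfl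
      rw [idPath, this]
      exact fun {_} h k χ => hφ.1 h k χ
    exact key _ (HPath.append_nil _) rfl
  | _, .cons K Ks => hφ.2 K Ks ⟨K, idH K, isCartesian_idH K⟩

theorem LeftKan.comp {A B M : 𝒦} {d : A ⟶ M} {P : HPath A B} {K : HorData.Hor A B} {l : B ⟶ M}
    {φ : Cell (𝟙 A) P (𝟙 B) (.single K)} {η : Cell d (HTgt.single K).toPath l (.nil M)}
    (hφ : ∀ {C : 𝒦} (H : HPath B C),
      WeaklyNullaryCocartesian ((CellPath.single φ).appendEq (idPath H) rfl rfl))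
    (hη : LeftKan η) :
    LeftKan (vcomp (.single φ) η (Category.id_comp d) (Category.id_comp l)) := by
  intro C H k χ
  have e : ∀ ξ : Cell l H k (.nil M),
      hcomp (vcomp (.single φ) η (Category.id_comp d) (Category.id_comp l)) ξ rfl =
      vcomp ((CellPath.single φ).appendEq (idPath H) rfl rfl) (hcomp η ξ rfl)
        (Category.id_comp d) (Category.id_comp k) := by
    intro ξ
    refine Eq.trans ?_ (vcomp_hcomp (.single φ) (idPath H) η ξ rfl rfl (Category.id_comp d)
      (Category.id_comp l) (Category.id_comp k))
    rw [vcomp_idPath]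
  obtain ⟨ζ, hζ, hζu⟩ :=
    WeaklyNullaryCocartesian.existsUnique (hφ H) χ (Category.id_comp d) (Category.id_comp k)
  obtain ⟨ξ, hξ, hξu⟩ := hη H k ζ
  refine ⟨ξ, by dsimp only; rw [e, hξ, hζ], fun ξ' hξ' => hξu ξ' (hζu _ ?_)⟩
  dsimp only at hξ' ⊢
  rw [← e, hξ']

/-- Left Kan extensions are unique up to invertible vertical cells. -/
theorem LeftKan.exists_iso {A B M : 𝒦} {d : A ⟶ M} {J : HorData.Hor A B} {l l' : B ⟶ M}
    {η : Cell d (HTgt.single J).toPath l (.nil M)} {η' : Cell d (HTgt.single J).toPath l' (.nil M)}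
    (hη : LeftKan η) (hη' : LeftKan η') :
    ∃ (θ : Cell l (.nil B) l' (.nil M)) (θ' : Cell l' (.nil B) l (.nil M)),
      hcomp θ θ' rfl = idV l ∧ hcomp θ' θ rfl = idV l' := by
  obtain ⟨θ, hθ, -⟩ := hη (.nil B) l' η'
  obtain ⟨θ', hθ', -⟩ := hη' (.nil B) l η
  refine ⟨θ, θ', (hη (.nil B) l η).unique ?_ (hcomp_idV η),
    (hη' (.nil B) l' η').unique ?_ (hcomp_idV η')⟩
  · rw [← hcomp_assoc _ _ _ rfl rfl rfl rfl, hθ, hθ']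
  · rw [← hcomp_assoc _ _ _ rfl rfl rfl rfl, hθ', hθ]

end Notions

section Squares

variable {𝒦 : Type u₁} [AugVirtDblCat.{w₁, x₁, v₁} 𝒦]

/-- `κ ∘ (id ∘ (ρ, φ)) = (κ ∘ ρ) ⊙ φ` -/
theorem vcomp_idH_pair_vcomp {X Y Z E P : 𝒦} {e : X ⟶ E} {f : Y ⟶ P} {g : Z ⟶ P} {J : HPath X Y}
    {H : HPath Y Z} {Q : HPath X Z} {K : HorData.Hor E P} {y p : _ ⟶ P} (ρ : Cell e J f (.single K))
    (φ : Cell f H g (.nil P)) (κ : Cell y (HTgt.single K).toPath (𝟙 P) (.nil P))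
    (hQ : Q = J.append H) (hp : e ≫ y = p) :
    vcomp (.single (vcomp (.cons ρ (.single φ) hQ rfl) (idH K) (Category.comp_id e)
      (Category.comp_id g))) κ hp (Category.comp_id g) =
    hcomp (vcomp (.single ρ) κ hp (Category.comp_id f)) φ hQ := by
  refine (vcomp_single_vcomp _ (idH K) κ _ _ _ _ (Category.id_comp y) (Category.id_comp _)
    hp (Category.comp_id g)).trans ?_
  rw [vcomp_single_idH]
  have h := vcomp_hcomp (.single ρ) (.single φ) κ (idV (𝟙 P)) rfl hQ hp (Category.comp_id f)
    (Category.comp_id g)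
  rw [single_vcomp_idV] at h
  refine Eq.trans ?_ h.symm
  exact congrArg (fun t => vcomp (.cons ρ (.single φ) hQ rfl) t hp (Category.comp_id g))
    (hcomp_idV κ).symm

theorem hcomp_whisker_eq {A E P M X Y Z : 𝒦} {e : X ⟶ E} {f : Y ⟶ P} {g : Z ⟶ P}
    {I : HorData.Hor A X} {J : HorData.Hor X Y} {H : HPath Y Z} {ι : HorData.Hor A E}
    {K : HorData.Hor E P} {L : HorData.Hor A P} {y : A ⟶ M} {ε : P ⟶ M}
    (α : Cell (𝟙 A) (HTgt.single I).toPath e (.single ι))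
    (ρ : Cell e (HTgt.single J).toPath f (.single K)) (φ : Cell f H g (.nil P))
    (w : Cell (𝟙 A) (.cons ι (.cons K (.nil P))) (𝟙 P) (.single L))
    (c : Cell y (HTgt.single L).toPath ε (.nil M)) :
    hcomp (vcomp (.single (vcomp (.cons α (.single ρ) rfl rfl) w (Category.comp_id _)
      (Category.comp_id f))) c (Category.id_comp y) rfl) (whisker φ ε) rfl =
    vcomp (.single (vcomp (.cons α (.single (vcomp (.cons ρ (.single φ) rfl rfl) (idH K)
      (Category.comp_id e) (Category.comp_id g))) rfl rfl) w (Category.comp_id _)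
      (Category.comp_id g))) c (Category.id_comp y) rfl := by
  have l := vcomp_single_vcomp (.cons α (.single ρ) rfl rfl) w c (Category.comp_id _)
      (Category.comp_id f) (Category.id_comp y) rfl (Category.id_comp y) (Category.id_comp ε)
      (Category.id_comp y) rfl
  have r := vcomp_single_vcomp (.cons α (.single (vcomp (.cons ρ (.single φ) rfl rfl) (idH K)
      (Category.comp_id e) (Category.comp_id g))) rfl rfl) w c (Category.comp_id _)
      (Category.comp_id g) (Category.id_comp y) rfl (Category.id_comp y) (Category.id_comp ε)
      (Category.id_comp y) rfl
  refine (congrArg (fun t => hcomp t (whisker φ ε) rfl) l).trans (Eq.trans ?_ r.symm)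
  generalize vcomp (.single w) c (Category.id_comp y) (Category.id_comp ε) = d
  have l' := vcomp_hcomp (.cons α (.single ρ) rfl rfl) (.single φ) d (idV ε) rfl rfl
    (Category.id_comp y) rfl rfl
  have r' := vcomp_pair_vcomp (.single α) (idH ι) (.cons ρ (.single φ) rfl rfl) (idH K) d rfl rfl rfl
    (Category.comp_id _) (Category.comp_id e) (Category.comp_id g) (Category.id_comp y) rfl
    (Category.id_comp y) (Category.id_comp ε) (Category.id_comp y) rfl
  rw [single_vcomp_idH] at r'
  refine l'.trans (Eq.trans ?_ r'.symm)
  exact congrArg (fun t => vcomp (.cons α (.cons ρ (.single φ) rfl rfl) rfl rfl) t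
    (Category.id_comp y) rfl) ((hcomp_idV d).trans (vcomp_idPath d _ _).symm)

theorem vcomp_copy_idH {A E B D P : 𝒦} {e : E ⟶ E} (he : e = 𝟙 E) {f : B ⟶ P}
    {ι : HorData.Hor A E} {J : HorData.Hor E B} {K : HorData.Hor E P} {L : HTgt A D} {l : P ⟶ D}
    {q : B ⟶ D} (ρ : Cell e (HTgt.single J).toPath f (.single K))
    (w : Cell (𝟙 A) (.cons ι (.cons K (.nil P))) l L) (hq : f ≫ l = q) :
    vcomp (.cons (copy (idH ι) rfl he.symm) (.single ρ) rfl rfl) w (Category.comp_id _) hq =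
      vcomp (.cons (idH ι) (.single (copy ρ he rfl)) rfl rfl) w (Category.comp_id _) hq := by
  subst he
  rfl

end Squares

section Adjunct

variable {𝒦 : Type u₁} [AugVirtDblCat.{w₁, x₁, v₁} 𝒦]
  {ℒ : Type u₂} [AugVirtDblCat.{w₂, x₂, v₂} ℒ] (F : AVDFunctor 𝒦 ℒ)
  {A PA : ℒ} {A' PA' : 𝒦} {ι : HorData.Hor A (F.obj A')} {yA : A ⟶ PA} {yA' : A' ⟶ PA'}

/-- The nullary cell `(ι, F J) ⇒ PA` induced by a cell `J ⇒ y_*`. -/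
def adjunctNullary {yStar : Companion yA'} (yFlat : Adjunct F ι yStar.hor) {ε : F.obj PA' ⟶ PA}
    (c : Cell yA (HTgt.single yFlat.hor).toPath ε (.nil PA)) {B : 𝒦} {f : B ⟶ PA'}
    {J : HorData.Hor A' B} (ρ : Cell (𝟙 A') (HTgt.single J).toPath f (.single yStar.hor)) :
    Cell yA (.cons ι (.cons (F.mapHor J) (.nil _))) (F.map f ≫ ε) (.nil PA) :=
  vcomp (.single (vcomp (.cons (copy (idH ι) rfl (F.map_id A').symm) (.single (F.mapCell ρ)) rfl rfl)
    yFlat.cell (Category.comp_id _) (Category.comp_id _))) c (Category.id_comp yA) rfl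

variable {F}

/-- `adjunctNullary` factors through the adjunct of `J` as a cartesian cell if `J` is the
restriction of `y_*` along `f`. -/
theorem exists_isCartesian_adjunct
    (hpres : ∀ {B : 𝒦} (f : B ⟶ PA') (r : Restriction yA' (.nil PA') f),
      IsCartesian (.single (F.mapHor r.hor)) (F.mapCell r.cell))
    {yStar : Companion yA'} (yFlat : Adjunct F ι yStar.hor) {ε : F.obj PA' ⟶ PA}
    {c : Cell yA (HTgt.single yFlat.hor).toPath ε (.nil PA)} (hc : IsCartesian (.single yFlat.hor) c)
    {B : 𝒦} {f : B ⟶ PA'} {J : HorData.Hor A' B} {κ : Cell yA' (HTgt.single J).toPath f (.nil PA')}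
    (hκ : IsCartesian (.single J) κ)
    {ρ : Cell (𝟙 A') (HTgt.single J).toPath f (.single yStar.hor)}
    (hρ : vcomp (.single ρ) yStar.cell (Category.id_comp _) (Category.comp_id _) = κ)
    (Jb : Adjunct F ι J) :
    ∃ cf : Cell yA (HTgt.single Jb.hor).toPath (F.map f ≫ ε) (.nil PA),
      IsCartesian (.single Jb.hor) cf ∧
      vcomp (.single Jb.cell) cf (Category.id_comp _) (Category.id_comp _) =
        adjunctNullary F yFlat c ρ := by
  have hFρ : IsCartesian (.single (F.mapHor J)) (F.mapCell ρ) := by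
    have h : IsCartesian (.single (F.mapHor J)) (F.mapCell κ) := hpres f ⟨J, κ, hκ⟩
    rw [← hρ, F.map_vcomp'] at h
    have h' : IsCartesian (.single (F.mapHor yStar.hor)) (F.mapCell yStar.cell) :=
      hpres (𝟙 PA') yStar
    exact fun {_ _} => IsCartesian.of_comp (S := .single (F.mapHor J))
      (T := .single (F.mapHor yStar.hor)) (φ := F.mapCell ρ) (ψ := F.mapCell yStar.cell) h h'
  let r : Restriction (𝟙 (F.obj A')) (.single (F.mapHor yStar.hor)) (F.map f) :=
    ⟨F.mapHor J, copy (F.mapCell ρ) (F.map_id A') rfl, hFρ.copy _ _⟩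
  obtain ⟨⟨s⟩, hs⟩ := yFlat.cocart.2 (F.map f) r
  obtain ⟨φ, hφ, -⟩ := IsCartesian.existsUnique s.cart
    (vcomp ((idPath (HTgt.single ι).toPath).append (.single r.cell)) yFlat.cell
      (Category.comp_id (𝟙 A)) (Category.comp_id (F.map f))) (Category.comp_id (𝟙 A))
      (Category.id_comp (F.map f))
  have hφ' := hs s φ hφ
  obtain ⟨u, hu, huφ⟩ := WeaklyUnaryCocartesian.exists_iso Jb.cocart.1.2.1 hφ'.2.1
  refine ⟨vcomp (.single (vcomp (.single u) s.cell (Category.comp_id (𝟙 A))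
    (Category.id_comp (F.map f)))) c (Category.id_comp yA) rfl,
    IsCartesian.comp (IsCartesian.comp hu s.cart _ _) hc _ _, ?_⟩
  rw [← vcomp_single_vcomp _ _ _ (Category.comp_id (𝟙 A)) (Category.id_comp (F.map f))
    (Category.id_comp yA) rfl, ← vcomp_single_vcomp _ _ _ (Category.comp_id (𝟙 A))
    (Category.comp_id _) (Category.comp_id (𝟙 A)) (Category.id_comp (F.map f)), huφ, hφ]
  exact congrArg (fun t => vcomp (.single t) c (Category.id_comp yA) rfl)
    (vcomp_copy_idH (F.map_id A') (J := F.mapHor J) (K := F.mapHor yStar.hor) (F.mapCell ρ)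
      yFlat.cell (Category.comp_id _)).symm

theorem AVDFunctor.map_idH_pair {X Y Z E P : 𝒦} {e : X ⟶ E} {f : Y ⟶ P}
    {g : Z ⟶ P} {J : HorData.Hor X Y} {H : HPath Y Z} {K : HorData.Hor E P}
    (F : AVDFunctor 𝒦 ℒ) (ρ : Cell e (HTgt.single J).toPath f (.single K))
    (φ : Cell f H g (.nil P)) :
    F.mapCell (vcomp (.cons ρ (.single φ) rfl rfl) (idH K) (Category.comp_id e)
      (Category.comp_id g)) =
    vcomp (.cons (F.mapCell ρ) (.single (F.mapCell φ)) rfl rfl) (idH (F.mapHor K))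
      (Category.comp_id (F.map e)) (Category.comp_id (F.map g)) := by
  rw [F.map_vcomp', F.map_idH, vcomp_copy]
  rfl

/-- `ε ∘ F-` is a bijection on nullary cells. -/
theorem bijective_whisker_map (hι : LocallyUniversalH F ι) (hyA : Dense yA) (hyA' : Dense yA')
    (hres : ∀ {B : 𝒦} (f : B ⟶ PA'), Nonempty (Restriction yA' (.nil PA') f))
    (hpres : ∀ {B : 𝒦} (f : B ⟶ PA') (r : Restriction yA' (.nil PA') f),
      IsCartesian (.single (F.mapHor r.hor)) (F.mapCell r.cell))
    {yStar : Companion yA'} (yFlat : Adjunct F ι yStar.hor) {ε : F.obj PA' ⟶ PA}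
    {c : Cell yA (HTgt.single yFlat.hor).toPath ε (.nil PA)} (hc : IsCartesian (.single yFlat.hor) c)
    {X Y : 𝒦} (f : X ⟶ PA') (g : Y ⟶ PA') (H : HPath X Y) :
    Function.Bijective (fun φ : Cell f H g (.nil PA') =>
      whisker (M := F.obj PA') (F.mapCell φ) ε) := by
  obtain ⟨⟨J, κ, hκ⟩⟩ := hres f
  obtain ⟨Jb⟩ := hι.adjunct J
  obtain ⟨ρ, hρ, -⟩ := IsCartesian.existsUnique yStar.cart κ (Category.id_comp _) (Category.comp_id _)
  obtain ⟨cf, hcf, hd⟩ := exists_isCartesian_adjunct hpres yFlat hc hκ hρ Jb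
  have hκL : LeftKan κ := hyA' J f κ hκ
  have hdL : LeftKan (adjunctNullary F yFlat c ρ) := by
    rw [← hd]
    exact LeftKan.comp Jb.cocart.1.1.append_idPath (hyA _ _ cf hcf)
  let β : Cell f H g (.nil PA') →
      Cell (𝟙 A') ((HTgt.single J).toPath.append H) g (.single yStar.hor) :=
    fun φ => vcomp (.cons ρ (.single φ) rfl rfl) (idH yStar.hor) (Category.comp_id _)
      (Category.comp_id g)
  have hβ : ∀ φ, vcomp (.single (β φ)) yStar.cell (Category.id_comp _) (Category.comp_id _) =
      hcomp κ φ rfl := fun φ => by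
    rw [← hρ]
    exact vcomp_idH_pair_vcomp ρ φ yStar.cell rfl (Category.id_comp _)
  let r : Restriction (𝟙 A) (.single ι) (F.map (𝟙 A')) :=
    ⟨ι, copy (idH ι) rfl (F.map_id A').symm, IsCartesian.copy (isCartesian_idH ι) _ _⟩
  have hb := hι.bijective (𝟙 A') g ((HTgt.single J).toPath.append H) yStar.hor yFlat r
  have hsq : ∀ φ : Cell f H g (.nil PA'), hcomp (adjunctNullary F yFlat c ρ)
      (whisker (M := F.obj PA') (F.mapCell φ) ε) rfl =
      vcomp (.single (vcomp (.cons r.cell (.single (F.mapCell (β φ))) rfl rfl) yFlat.cell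
        (Category.comp_id (𝟙 A)) (Category.comp_id (F.map g)))) c (Category.id_comp yA) rfl := by
    intro φ
    refine (hcomp_whisker_eq (J := F.mapHor J) (K := F.mapHor yStar.hor) (P := F.obj PA') r.cell
      (F.mapCell ρ) (F.mapCell φ) yFlat.cell c).trans ?_
    rw [F.map_idH_pair]
  constructor
  · intro φ φ' h
    have h₁ := (hsq φ).symm.trans ((congrArg (fun t => hcomp _ t rfl) h).trans (hsq φ'))
    have h₂ : β φ = β φ' := hb.1 (hc.hom_ext _ _ h₁)
    refine (hκL H g (hcomp κ φ' rfl)).unique ?_ rfl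
    rw [← hβ, ← hβ, h₂]
  · intro ψ
    obtain ⟨ζ, hζ, -⟩ := hc.existsUnique (h := 𝟙 A) (k := F.map g)
      (hcomp (adjunctNullary F yFlat c ρ) ψ rfl) (Category.id_comp yA) rfl
    obtain ⟨ξ, hξ⟩ := hb.2 ζ
    obtain ⟨φ, hφ, -⟩ := hκL H g
      (vcomp (.single ξ) yStar.cell (Category.id_comp _) (Category.comp_id _))
    have e : β φ = ξ := IsCartesian.hom_ext yStar.cart _ _ ((hβ φ).trans hφ)
    refine ⟨φ, (hdL _ _ (hcomp (adjunctNullary F yFlat c ρ) ψ rfl)).unique ?_ rfl⟩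
    dsimp only at hξ ⊢
    rw [hsq, e, hξ, hζ]

/-- `ε` is universal relative to the `ι`-small morphisms. -/
theorem universalRelativeTo_iotaSmall (hι : LocallyUniversalH F ι) (hyA : Dense yA)
    (hyA' : IsYoneda yA')
    (hres : ∀ {B : 𝒦} (f : B ⟶ PA'), Nonempty (Restriction yA' (.nil PA') f))
    (hpres : ∀ {B : 𝒦} (f : B ⟶ PA') (r : Restriction yA' (.nil PA') f),
      IsCartesian (.single (F.mapHor r.hor)) (F.mapCell r.cell))
    {yStar : Companion yA'} (yFlat : Adjunct F ι yStar.hor) {ε : F.obj PA' ⟶ PA}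
    {c : Cell yA (HTgt.single yFlat.hor).toPath ε (.nil PA)}
    (hc : IsCartesian (.single yFlat.hor) c) :
    UniversalRelativeTo F ε (IotaSmall F ι yA) := by
  have hb := fun {X Y : 𝒦} (f : X ⟶ PA') (g : Y ⟶ PA') (H : HPath X Y) =>
    bijective_whisker_map hι hyA hyA'.dense hres hpres yFlat hc f g H
  have hL : ∀ {B : 𝒦} {f : B ⟶ PA'} {J : HorData.Hor A' B}
      {κ : Cell yA' (HTgt.single J).toPath f (.nil PA')} (_ : IsCartesian (.single J) κ)
      (Jb : Adjunct F ι J),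
      ∃ cf : Cell yA (HTgt.single Jb.hor).toPath (F.map f ≫ ε) (.nil PA), LeftKan cf := by
    intro B f J κ hκ Jb
    obtain ⟨ρ, hρ, -⟩ := IsCartesian.existsUnique yStar.cart κ (Category.id_comp _) (Category.comp_id _)
    obtain ⟨cf, hcf, -⟩ := exists_isCartesian_adjunct hpres yFlat hc hκ hρ Jb
    exact ⟨cf, hyA _ _ cf hcf⟩
  have hfull : (postcomp F ε).Full := ⟨fun {a b} ψ => by
    obtain ⟨H, ψ⟩ := ψ
    obtain ⟨φ, hφ⟩ := (hb a.mor b.mor H).2 ψ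
    exact ⟨⟨H, φ⟩, congrArg (FSlice.Hom.mk (F := F) (X := PA)
      (a := (postcomp F ε).obj a) (b := (postcomp F ε).obj b) H) hφ⟩⟩
  have hfaith : (postcomp F ε).Faithful := ⟨fun {a b} φ φ' h => by
    obtain ⟨H, φ⟩ := φ
    obtain ⟨H', φ'⟩ := φ'
    obtain ⟨h₁, h₂⟩ := (FSlice.Hom.mk.injEq ..).mp h
    dsimp only at h₁
    subst h₁
    exact congrArg (VSlice.Hom.mk H) ((hb a.mor b.mor H).1 (eq_of_heq h₂))⟩
  have hsmall : ∀ a, IotaSmall F ι yA ((postcomp F ε).obj a) := by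
    intro a
    obtain ⟨⟨J, κ, hκ⟩⟩ := hres a.mor
    obtain ⟨Jb⟩ := hι.adjunct J
    obtain ⟨cf, hcf⟩ := hL hκ Jb
    exact ⟨J, Jb, cf, hcf⟩
  refine ⟨⟨hfull, hfaith⟩, hsmall, { essSurj := ⟨fun ⟨a, J, Jb, η, hη⟩ => ?_⟩ }⟩
  obtain ⟨f, κ, hκ⟩ := hyA'.yoneda J
  obtain ⟨cf, hcf⟩ := hL hκ Jb
  obtain ⟨θ, θ', h₁, h₂⟩ := hcf.exists_iso hη
  refine ⟨⟨a.pt, f⟩, ⟨(IotaSmall F ι yA).isoMk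
    { hom := ⟨.nil a.pt, θ⟩
      inv := ⟨.nil a.pt, θ'⟩
      hom_inv_id := congrArg (FSlice.Hom.mk (F := F) (X := PA)
        (a := ⟨a.pt, F.map f ≫ ε⟩) (b := ⟨a.pt, F.map f ≫ ε⟩) (.nil a.pt)) h₁
      inv_hom_id := congrArg (FSlice.Hom.mk (F := F) (X := PA) (a := a) (b := a) (.nil a.pt)) h₂ }⟩⟩

end Adjunct

section Units

variable {𝒦 : Type u₁} [AugVirtDblCat.{w₁, x₁, v₁} 𝒦]

/-- The cartesian cell of a horizontal unit has an inverse. -/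
theorem Restriction.exists_unit_inverse {A : 𝒦} (U : Restriction (𝟙 A) (.nil A) (𝟙 A)) :
    ∃ η : Cell (𝟙 A) (.nil A) (𝟙 A) (.single U.hor),
      vcomp (.single η) U.cell (Category.comp_id _) (Category.comp_id _) = idV (𝟙 A) ∧
      vcomp (.single U.cell) η (Category.comp_id _) (Category.comp_id _) = idH U.hor := by
  have i : 𝟙 A ≫ 𝟙 A = 𝟙 A := Category.comp_id _
  obtain ⟨η, hη, -⟩ := IsCartesian.existsUnique U.cart (idV (𝟙 A)) i i
  refine ⟨η, hη, IsCartesian.hom_ext U.cart i i ?_⟩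
  refine (vcomp_single_vcomp _ _ _ _ _ _ _ i i i i).trans ?_
  rw [hη]
  exact (single_vcomp_idV _ _ _).trans (vcomp_single_idH U.cell i i).symm

/-- Composing with a horizontal unit on the right is cocartesian. -/
theorem weaklyUnaryCocartesian_of_unit {A E : 𝒦} (J : HorData.Hor A E) {U : HorData.Hor E E}
    {η : Cell (𝟙 E) (.nil E) (𝟙 E) (.single U)}
    {κ : Cell (𝟙 E) (HTgt.single U).toPath (𝟙 E) (.nil E)}
    (h₁ : vcomp (.single η) κ (Category.comp_id _) (Category.comp_id _) = idV (𝟙 E))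
    (h₂ : vcomp (.single κ) η (Category.comp_id _) (Category.comp_id _) = idH U) :
    WeaklyUnaryCocartesian (.single (vcomp (.cons (idH J) (.single κ) rfl rfl) (idH J)
      (Category.comp_id _) (Category.comp_id _) :
        Cell (𝟙 A) (.cons J (.cons U (.nil E))) (𝟙 E) (.single J))) := by
  have i : ∀ X : 𝒦, 𝟙 X ≫ 𝟙 X = 𝟙 X := fun X => Category.comp_id _
  have e₁ : vcomp (.cons (idH J) (.single η) rfl rfl) (vcomp (.cons (idH J) (.single κ) rfl rfl)
      (idH J) (i A) (i E)) (i A) (i E) = idH J := by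
    have h := vcomp_pair_vcomp (.single (idH J)) (idH J) (.single η) κ (idH J) rfl rfl rfl
      (i A) (i E) (i E) (i A) (i E) (i A) (i E) (i A) (i E)
    rw [h₁, vcomp_single_idH] at h
    refine h.symm.trans ?_
    exact (vcomp_insert' (.single (idH J)) (.nil (𝟙 E)) (idH J) (i A) (i E)).trans
      (vcomp_single_idH (idH J) (i A) (i E))
  have key : ∀ {X Y : 𝒦} {h p : A ⟶ X} {k q : E ⟶ Y} {L : HorData.Hor X Y}
      (χ : Cell p (.cons J (.cons U (.nil E))) q (.single L)) (_ : h = p) (_ : k = q)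
      (hp : 𝟙 A ≫ h = p) (hq : 𝟙 E ≫ k = q),
      ∃! χ' : Cell h (HTgt.single J).toPath k (.single L),
        vcomp (.single (vcomp (.cons (idH J) (.single κ) rfl rfl) (idH J) (i A) (i E))) χ' hp hq =
          χ := by
    intro X Y h p k q L χ hp hq hp' hq'
    subst hp hq
    refine ⟨vcomp (.cons (idH J) (.single η) rfl rfl) χ hp' hq', ?_, fun χ' hχ' => ?_⟩
    · refine (vcomp_single_vcomp _ _ _ _ _ _ _ hp' hq' hp' hq').trans ?_
      rw [vcomp_single_idH]
      have h := vcomp_pair_vcomp (.single (idH J)) (idH J) (.single κ) η χ rfl rfl rfl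
        (i A) (i E) (i E) hp' hq' hp' hq' hp' hq'
      rw [h₂, vcomp_single_idH] at h
      exact h.symm.trans (vcomp_idPath χ _ _)
    · rw [← hχ']
      refine Eq.symm ((vcomp_single_vcomp (.cons (idH J) (.single η) rfl rfl) (vcomp (.cons (idH J)
        (.single κ) rfl rfl) (idH J) (i A) (i E)) χ' (i A) (i E) hp' hq' hp' hq' hp'
        hq').symm.trans ?_)
      rw [e₁, vcomp_single_idH]
  exact fun {_ _} h k L χ => key χ (Category.id_comp h).symm (Category.id_comp k).symm _ _

/-- Yoneda morphisms out of unital objects are full and faithful. -/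
theorem IsYoneda.isCartesian_unit {A P : 𝒦} {y : A ⟶ P} (hy : IsYoneda y)
    (U : Restriction (𝟙 A) (.nil A) (𝟙 A)) :
    IsCartesian (.single U.hor)
      (vcomp (.single U.cell) (idV y) (Category.id_comp y) (Category.id_comp y)) := by
  have i : ∀ {X : 𝒦} (f : A ⟶ X), 𝟙 A ≫ f = f := fun f => Category.id_comp f
  obtain ⟨η, h₁, h₂⟩ := U.exists_unit_inverse
  obtain ⟨l, ζ, hζ⟩ := hy.yoneda U.hor
  have hK : LeftKan ζ := hy.dense _ _ ζ hζ
  obtain ⟨θ', hθ', -⟩ := hK (.nil A) y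
    (vcomp (.single U.cell) (idV y) (Category.id_comp y) (Category.id_comp y))
  have e₁ : hcomp (vcomp (.single η) ζ (i y) (i l)) θ' rfl = idV y := by
    have h := vcomp_hcomp (.single η) (.nil (𝟙 A)) ζ θ' rfl rfl (i y) (i l) (i y)
    rw [vcomp_nil_id] at h
    refine h.trans ?_
    rw [hθ']
    refine (vcomp_single_vcomp (.single η) U.cell (idV y) (i _) (i _) (i y) (i y) (i y) (i y)
      (i y) (i y)).symm.trans ?_
    rw [h₁]
    exact idV_idV' _ _ _
  have e₂ : hcomp (vcomp (.single U.cell) (idV y) (i y) (i y)) (vcomp (.single η) ζ (i y) (i l))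
      rfl = ζ := by
    have h := vcomp_hcomp (.single U.cell) (.nil (𝟙 A)) (idV y) (vcomp (.single η) ζ (i y) (i l))
      rfl rfl (i y) (i y) (i l)
    rw [vcomp_nil_id, idV_hcomp] at h
    refine h.trans ((vcomp_single_vcomp (.single U.cell) η ζ (i _) (i _) (i y) (i l) (i y) (i l)
      (i y) (i l)).symm.trans ?_)
    rw [h₂, vcomp_single_idH]
  have e₃ : hcomp θ' (vcomp (.single η) ζ (i y) (i l)) rfl = idV l := by
    refine (hK (.nil A) l ζ).unique ?_ (hcomp_idV ζ)
    rw [← hcomp_assoc _ _ _ rfl rfl rfl rfl, hθ', e₂]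
  rw [← hθ']
  exact fun {_ _} => IsCartesian.hcomp (S := .single U.hor) hζ e₃ e₁

end Units

section MapUnits

variable {𝒦 : Type u₁} [AugVirtDblCat.{w₁, x₁, v₁} 𝒦]
  {ℒ : Type u₂} [AugVirtDblCat.{w₂, x₂, v₂} ℒ]

/-- Functors preserve horizontal units. -/
theorem AVDFunctor.map_unit (F : AVDFunctor 𝒦 ℒ) {A : 𝒦} {U : HorData.Hor A A}
    {η : Cell (𝟙 A) (.nil A) (𝟙 A) (.single U)}
    {κ : Cell (𝟙 A) (HTgt.single U).toPath (𝟙 A) (.nil A)}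
    (h₁ : vcomp (.single η) κ (Category.comp_id _) (Category.comp_id _) = idV (𝟙 A))
    (h₂ : vcomp (.single κ) η (Category.comp_id _) (Category.comp_id _) = idH U) :
    ∃ (η' : Cell (𝟙 (F.obj A)) (.nil _) (𝟙 _) (.single (F.mapHor U)))
      (κ' : Cell (𝟙 (F.obj A)) (HTgt.single (F.mapHor U)).toPath (𝟙 _) (.nil _)),
      vcomp (.single η') κ' (Category.comp_id _) (Category.comp_id _) = idV (𝟙 _) ∧
      vcomp (.single κ') η' (Category.comp_id _) (Category.comp_id _) = idH (F.mapHor U) := by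
  have key : ∀ {e : F.obj A ⟶ F.obj A} (he : e = 𝟙 _)
      (η' : Cell e (.nil _) e (.single (F.mapHor U)))
      (κ' : Cell e (HTgt.single (F.mapHor U)).toPath e (.nil _)) (hp : e ≫ e = e),
      vcomp (.single η') κ' hp hp = idV e →
      vcomp (.single κ') η' hp hp = copy (idH (F.mapHor U)) he.symm he.symm →
      ∃ (η' : Cell (𝟙 (F.obj A)) (.nil _) (𝟙 _) (.single (F.mapHor U)))
        (κ' : Cell (𝟙 (F.obj A)) (HTgt.single (F.mapHor U)).toPath (𝟙 _) (.nil _)),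
        vcomp (.single η') κ' (Category.comp_id _) (Category.comp_id _) = idV (𝟙 _) ∧
        vcomp (.single κ') η' (Category.comp_id _) (Category.comp_id _) = idH (F.mapHor U) := by
    intro e he η' κ' hp a b
    subst he
    exact ⟨η', κ', a, b⟩
  have a := congrArg F.mapCell h₁
  have b := congrArg F.mapCell h₂
  rw [F.map_vcomp', F.map_idV] at a
  rw [F.map_vcomp', F.map_idH] at b
  exact key (F.map_id A) (F.mapCell η) (F.mapCell κ) _ a b

end MapUnits

end AVDC

theorem mainTheorem2
    {𝒦 : Type u₁} [AugVirtDblCat.{w₁, x₁, v₁} 𝒦]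
    {ℒ : Type u₂} [AugVirtDblCat.{w₂, x₂, v₂} ℒ] (F : AVDFunctor 𝒦 ℒ)
    {A : ℒ} {A' : 𝒦} (ι : HorData.Hor A (F.obj A')) (hι : LocallyUniversalH F ι)
    {PA : ℒ} (yA : A ⟶ PA) (hyA : IsYoneda yA)
    {PA' : 𝒦} (yA' : A' ⟶ PA') (hyA' : IsYoneda yA')
    -- the restrictions `PA'(y_{A'}, f)` exist and are preserved by `F`
    (hres : ∀ {B : 𝒦} (f : B ⟶ PA'), Nonempty (Restriction yA' (.nil PA') f))
    (hpres : ∀ {B : 𝒦} (f : B ⟶ PA') (r : Restriction yA' (.nil PA') f),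
      IsCartesian (.single (F.mapHor r.hor)) (F.mapCell r.cell))
    -- the companion of `y_{A'}` and its adjunct
    (yStar : Companion yA') (yFlat : Adjunct F ι yStar.hor)
    (hflat : ∀ {B : 𝒦} (f : B ⟶ PA'),
      Nonempty (Restriction (𝟙 A) (.single yFlat.hor) (F.map f))) :
    (∃ (ε : F.obj PA' ⟶ PA) (c : Cell yA (HTgt.single yFlat.hor).toPath ε (.nil PA)),
      IsCartesian (.single yFlat.hor) c) ∧
    ∀ (ε : F.obj PA' ⟶ PA) (c : Cell yA (HTgt.single yFlat.hor).toPath ε (.nil PA)),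
      IsCartesian (.single yFlat.hor) c →
      UniversalRelativeTo F ε (IotaSmall F ι yA) ∧
      (Unital A' →
        ∃ c' : Cell yA (HTgt.single ι).toPath (F.map yA' ≫ ε) (.nil PA),
          IsCartesian (.single ι) c') := by
  refine ⟨hyA.yoneda yFlat.hor, fun ε c hc =>
    ⟨universalRelativeTo_iotaSmall hι hyA.dense hyA' hres hpres yFlat hc, fun ⟨U⟩ => ?_⟩⟩
  obtain ⟨η, h₁, h₂⟩ := U.exists_unit_inverse
  obtain ⟨η', κ', h₁', h₂'⟩ := F.map_unit h₁ h₂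
  obtain ⟨Jb⟩ := hι.adjunct U.hor
  obtain ⟨ρ, hρ, -⟩ := IsCartesian.existsUnique yStar.cart
    (vcomp (.single U.cell) (idV yA') (Category.id_comp yA') (Category.id_comp yA'))
    (Category.id_comp _) (Category.comp_id _)
  obtain ⟨cf, hcf, -⟩ := exists_isCartesian_adjunct hpres yFlat hc (hyA'.isCartesian_unit U) hρ Jb
  obtain ⟨u, hu, -⟩ := WeaklyUnaryCocartesian.exists_iso
    (weaklyUnaryCocartesian_of_unit ι h₁' h₂') Jb.cocart.1.2.1
  exact ⟨vcomp (.single u) cf (Category.id_comp _) (Category.id_comp _),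
    IsCartesian.comp hu hcf _ _⟩
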